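/- Let $d\in\mathbb N$, $c>0$, and let $\mathcal A=L^2(\mathbb R^d)\cap L^\infty(\mathbb R^d)$ (complex-valued functions modulo equality a.e., Lebesgue measure, pointwise product and conjugation), $\langle f,g\rangle=\int \bar f g$. Let $U$ be the unital complex $*$-algebra generated by $B^+_f,B_f,N_f$ ($f\in\mathcal A$), where $f\mapsto B^+_f$ and $f\mapsto N_f$ are linear and $f\mapsto B_f$ is conjugate linear, with involution $(B^+_f)^*=B_f$, $(N_f)^*=N_{\bar f}$ and relations $$[B_f,B^+_g]=2c\langle f,g\rangle+4N_{\bar fg},\qquad [N_a,B^+_f]=2B^+_{af},\qquad [B^+_f,B^+_g]=[B_f,B_g]=[N_a,N_{a'}]=0 .$$ There is exactly one state $\varphi_F$ on $U$ (a linear functional with $\varphi_F(1)=1$ and $\varphi_F(x^*x)\ge 0$) such that $\varphi_F(xB_g)=\varphi_F(xN_g)=0$ for all $x\in U$, $g\in\mathcal A$. Let $\Gamma_2(\mathcal A)$ be its GNS Hilbert space, with vacuum vector $\Phi$; let the $n$-particle space be the closed linear span of the vectors $B^{+n}_f\Phi$, $f\in\mathcal A$; and, for those $f\in\mathcal A$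 for which the series converges, let $\Psi(f)=\sum_{n\ge0}\frac1{n!}B^{+n}_f\Phi$ be the quadratic exponential vector. For a linear $T:\mathcal A\to\mathcal A$, the quadratic second quantization $\Gamma_2(T)$, if it exists, is the linear operator with domain the linear span of the exponential vectors and $\Gamma_2(T)\Psi(f)=\Psi(Tf)$ for every exponential vector $\Psi(f)$ (in particular $\Psi(Tf)$ exists whenever $\Psi(f)$ does). (1) Let $\varphi\in\mathcal A$ with $\|\varphi\|_\infty\le1$, let $T_1:\mathcal A\to\mathcal A$ be an algebra homomorphism (linear and multiplicative), and let $T=M_\varphi T_1$, i.e. $Tf=\varphi\cdot T_1f$. If $\|Tf\|_2\le\|f\|_2$ and $\|Tf\|_\infty\le\|f\|_\infty$ for all $f\in\mathcal A$, then $\Gamma_2(T)$ exists, is densely defined, and is a contraction: $\|\Gamma_2(T)x\|\le\|x\|$ for all $x$ in its domain. (2) For $z\in\mathbb C$ with $\operatorname{Re}z\le0$, let $e^{z}$ denote the operator $f\mapsto e^zf$ on $\mathcal A$. Then $\Gamma_2(e^{z})$ exists, is densely defined, and extends to a contraction $S(z)$ of $\Gamma_2(\mathcal A)$. One has $S(0)=1$,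 $S(z+w)=S(z)S(w)$ and $S(z)\Phi=\Phi$; $z\mapsto S(z)$ is norm holomorphic on $\{\operatorname{Re}z<0\}$ and strongly continuous on $\{\operatorname{Re}z\le0\}$; $S(it)$ is unitary for $t\in\mathbb R$. There is a positive self-adjoint operator $H_0$ (the quadratic free Hamiltonian) that is the generator of the unitary group, $S(it)=e^{itH_0}$, and of the contraction semigroup, $S(-t)=e^{-tH_0}$, $t\ge0$ (the quadratic Ornstein--Uhlenbeck semigroup), in the sense that each of the conditions $\frac{d}{dt}\big|_{t=0}S(it)v=iw$ and $\frac{d}{dt}\big|_{t=0^+}S(-t)v=-w$ is equivalent to $v\in D(H_0)$, $H_0v=w$. For each $n\in\mathbb N$ the $n$-particle space is $\{v\in D(H_0):H_0v=nv\}$, $S(z)$ acts on it as multiplication by $e^{zn}$, and the linear span of all $n$-particle spaces is dense in $\Gamma_2(\mathcal A)$. -/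

import Mathlib

set_option linter.unusedSimpArgs false

open MeasureTheory
open scoped ENNReal ComplexConjugate ComplexOrder

namespace QuadFock

/-- The space `L²(ℝᵈ) ∩ L^∞(ℝᵈ)` of (classes of) complex functions on `ℝᵈ`. -/
def testSubmodule (d : ℕ) :
    Submodule ℂ (EuclideanSpace ℝ (Fin d) →ₘ[volume] ℂ) where
  carrier := {f | MemLp f 2 volume ∧ MemLp f ∞ volume}
  add_mem' {f g} hf hg :=
    ⟨(memLp_congr_ae (AEEqFun.coeFn_add f g)).2 (hf.1.add hg.1),
      (memLp_congr_ae (AEEqFun.coeFn_add f g)).2 (hf.2.add hg.2)⟩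
  zero_mem' :=
    ⟨(memLp_congr_ae AEEqFun.coeFn_zero).2 MemLp.zero,
      (memLp_congr_ae AEEqFun.coeFn_zero).2 MemLp.zero⟩
  smul_mem' z f hf :=
    ⟨(memLp_congr_ae (AEEqFun.coeFn_smul z f)).2 (hf.1.const_smul z),
      (memLp_congr_ae (AEEqFun.coeFn_smul z f)).2 (hf.2.const_smul z)⟩

/-- The test function algebra `𝒜 = L²(ℝᵈ) ∩ L^∞(ℝᵈ)`. -/
abbrev TestAlg (d : ℕ) : Type := testSubmodule d

variable {d : ℕ}

/-- Pointwise product. -/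
noncomputable instance : Mul (TestAlg d) where
  mul f g := ⟨f.1 * g.1,
    (memLp_congr_ae (AEEqFun.coeFn_mul f.1 g.1)).2 (g.2.1.mul f.2.2),
    (memLp_congr_ae (AEEqFun.coeFn_mul f.1 g.1)).2 (g.2.2.mul f.2.2)⟩

/-- Pointwise complex conjugation. -/
noncomputable instance : Star (TestAlg d) where
  star f := ⟨star f.1,
    (memLp_congr_ae (AEEqFun.coeFn_star f.1)).2 f.2.1.star,
    (memLp_congr_ae (AEEqFun.coeFn_star f.1)).2 f.2.2.star⟩

theorem coe_mul (f g : TestAlg d) : ((f * g : TestAlg d) : EuclideanSpace ℝ (Fin d) →ₘ[volume] ℂ) = f.1 * g.1 := rfl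
theorem coe_star (f : TestAlg d) : ((star f : TestAlg d) : EuclideanSpace ℝ (Fin d) →ₘ[volume] ℂ) = star f.1 := rfl

theorem mul_ae (f g : TestAlg d) : ((f * g : TestAlg d).1 : EuclideanSpace ℝ (Fin d) → ℂ) =ᵐ[volume] fun x => f.1 x * g.1 x :=
  AEEqFun.coeFn_mul f.1 g.1
theorem star_ae (f : TestAlg d) : ((star f : TestAlg d).1 : EuclideanSpace ℝ (Fin d) → ℂ) =ᵐ[volume] fun x => star (f.1 x) :=
  AEEqFun.coeFn_star f.1
theorem add_ae (f g : TestAlg d) : ((f + g : TestAlg d).1 : EuclideanSpace ℝ (Fin d) → ℂ) =ᵐ[volume] fun x => f.1 x + g.1 x :=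
  AEEqFun.coeFn_add f.1 g.1
theorem smul_ae (z : ℂ) (f : TestAlg d) : ((z • f : TestAlg d).1 : EuclideanSpace ℝ (Fin d) → ℂ) =ᵐ[volume] fun x => z * f.1 x :=
  AEEqFun.coeFn_smul z f.1

theorem ext_ae {f g : TestAlg d} (h : (f.1 : EuclideanSpace ℝ (Fin d) → ℂ) =ᵐ[volume] g.1) : f = g :=
  Subtype.ext (AEEqFun.ext h)

noncomputable instance : NonUnitalCommRing (TestAlg d) where
  __ := (inferInstance : AddCommGroup (TestAlg d))
  __ := (inferInstance : Mul (TestAlg d))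
  left_distrib f g h := ext_ae <| by
    filter_upwards [mul_ae f (g + h), add_ae g h, add_ae (f * g) (f * h), mul_ae f g,
      mul_ae f h] with x h1 h2 h3 h4 h5
    rw [h1, h2, h3, h4, h5, mul_add]
  right_distrib f g h := ext_ae <| by
    filter_upwards [mul_ae (f + g) h, add_ae f g, add_ae (f * h) (g * h), mul_ae f h,
      mul_ae g h] with x h1 h2 h3 h4 h5
    rw [h1, h2, h3, h4, h5, add_mul]
  zero_mul f := ext_ae <| by
    filter_upwards [mul_ae 0 f, AEEqFun.coeFn_zero (α := EuclideanSpace ℝ (Fin d)) (β := ℂ) (μ := volume)] with x h1 h2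
    rw [h1]
    simp only [ZeroMemClass.coe_zero, h2, Pi.zero_apply, zero_mul]
  mul_zero f := ext_ae <| by
    filter_upwards [mul_ae f 0, AEEqFun.coeFn_zero (α := EuclideanSpace ℝ (Fin d)) (β := ℂ) (μ := volume)] with x h1 h2
    rw [h1]
    simp only [ZeroMemClass.coe_zero, h2, Pi.zero_apply, mul_zero]
  mul_assoc f g h := Subtype.ext (mul_assoc f.1 g.1 h.1)
  mul_comm f g := Subtype.ext (mul_comm f.1 g.1)

instance : IsScalarTower ℂ (TestAlg d) (TestAlg d) where
  smul_assoc z f g := ext_ae <| by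
    simp only [smul_eq_mul]
    filter_upwards [mul_ae (z • f) g, smul_ae z f, smul_ae z (f * g), mul_ae f g]
      with x h1 h2 h3 h4
    rw [h1, h2, h3, h4, mul_assoc]

instance : SMulCommClass ℂ (TestAlg d) (TestAlg d) where
  smul_comm z f g := by
    simp only [smul_eq_mul]
    rw [mul_comm f (z • g), smul_mul_assoc, mul_comm g f]

noncomputable instance : StarRing (TestAlg d) where
  star_involutive f := Subtype.ext (star_star f.1)
  star_mul f g := ext_ae <| by
    filter_upwards [star_ae (f * g), mul_ae f g, mul_ae (star g) (star f), star_ae g, star_ae f]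
      with x h1 h2 h3 h4 h5
    rw [h1, h2, h3, h4, h5, star_mul]
  star_add f g := ext_ae <| by
    filter_upwards [star_ae (f + g), add_ae f g, add_ae (star f) (star g), star_ae g, star_ae f]
      with x h1 h2 h3 h4 h5
    rw [h1, h2, h3, h4, h5, star_add]

instance : StarModule ℂ (TestAlg d) where
  star_smul z f := ext_ae <| by
    filter_upwards [star_ae (z • f), smul_ae z f, smul_ae (star z) (star f), star_ae f]
      with x h1 h2 h3 h4
    rw [h1, h2, h3, h4, star_mul']

/-- The scalar product `⟨f, g⟩ = ∫ conj f(s) g(s) ds` of `L²(ℝᵈ)`. -/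
noncomputable def l2inner (f g : TestAlg d) : ℂ := ∫ s, conj (f.1 s) * g.1 s

theorem integrable_l2inner (f g : TestAlg d) : Integrable (fun s => conj (f.1 s) * g.1 s) :=
  f.2.1.star.integrable_mul g.2.1

theorem l2inner_add_right (f g h : TestAlg d) : l2inner f (g + h) = l2inner f g + l2inner f h := by
  rw [l2inner, l2inner, l2inner, ← integral_add (integrable_l2inner f g) (integrable_l2inner f h)]
  refine integral_congr_ae ?_
  filter_upwards [add_ae g h] with x h1
  rw [h1, mul_add]

theorem l2inner_smul_right (z : ℂ) (f g : TestAlg d) : l2inner f (z • g) = z * l2inner f g := by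
  rw [l2inner, l2inner, ← integral_const_mul]
  refine integral_congr_ae ?_
  filter_upwards [smul_ae z g] with x h1
  rw [h1]; ring

theorem l2inner_conj (f g : TestAlg d) : conj (l2inner f g) = l2inner g f := by
  rw [l2inner, l2inner, ← integral_conj]
  congr 1; ext x; simp [mul_comm]

theorem l2inner_mul_left (f g h : TestAlg d) : l2inner (f * g) h = l2inner f (star g * h) := by
  refine integral_congr_ae ?_
  filter_upwards [mul_ae f g, mul_ae (star g) h, star_ae g] with x h1 h2 h3
  rw [h1, h2, h3, map_mul, mul_assoc]; rfl

theorem l2inner_self_nonneg (f : TestAlg d) : 0 ≤ l2inner f f := by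
  have : l2inner f f = ((∫ s, ‖f.1 s‖ ^ 2 : ℝ) : ℂ) := by
    rw [l2inner, ← integral_complex_ofReal]
    congr 1; ext x
    rw [Complex.conj_mul']; push_cast; rfl
  rw [this]
  exact_mod_cast integral_nonneg fun x => by positivity

/-- The generators of the algebra of the renormalized square of white noise. -/
inductive Gen (d : ℕ) : Type
  /-- the creators `B⁺_f` -/
  | cr (f : TestAlg d)
  /-- the annihilators `B_f` -/
  | an (f : TestAlg d)
  /-- the number operators `N_f` -/
  | nu (f : TestAlg d)

section relations
open FreeAlgebra

/-- The defining relations: `B⁺` and `N` are complex linear and `B` is conjugate linear in the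
test function, and the commutation relations hold, the central element being the unit. -/
inductive Rel (c : ℝ) (d : ℕ) : FreeAlgebra ℂ (Gen d) → FreeAlgebra ℂ (Gen d) → Prop
  | cr_add (f g : TestAlg d) : Rel c d (ι ℂ (.cr (f + g))) (ι ℂ (.cr f) + ι ℂ (.cr g))
  | cr_smul (z : ℂ) (f : TestAlg d) : Rel c d (ι ℂ (.cr (z • f))) (z • ι ℂ (.cr f))
  | an_add (f g : TestAlg d) : Rel c d (ι ℂ (.an (f + g))) (ι ℂ (.an f) + ι ℂ (.an g))
  | an_smul (z : ℂ) (f : TestAlg d) : Rel c d (ι ℂ (.an (z • f))) (conj z • ι ℂ (.an f))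
  | nu_add (f g : TestAlg d) : Rel c d (ι ℂ (.nu (f + g))) (ι ℂ (.nu f) + ι ℂ (.nu g))
  | nu_smul (z : ℂ) (f : TestAlg d) : Rel c d (ι ℂ (.nu (z • f))) (z • ι ℂ (.nu f))
  /-- `[B_f, B⁺_g] = 2c⟨f, g⟩ + 4 N_{conj f g}` -/
  | an_cr (f g : TestAlg d) : Rel c d
      (ι ℂ (.an f) * ι ℂ (.cr g) - ι ℂ (.cr g) * ι ℂ (.an f))
      (algebraMap ℂ _ (2 * c * l2inner f g) + (4 : ℂ) • ι ℂ (.nu (star f * g)))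
  /-- `[N_a, B⁺_f] = 2 B⁺_{a f}` -/
  | nu_cr (a f : TestAlg d) : Rel c d
      (ι ℂ (.nu a) * ι ℂ (.cr f) - ι ℂ (.cr f) * ι ℂ (.nu a)) ((2 : ℂ) • ι ℂ (.cr (a * f)))
  /-- `[B_f, N_a] = 2 B_{conj a f}`, the adjoint of the relation before -/
  | an_nu (a f : TestAlg d) : Rel c d
      (ι ℂ (.an f) * ι ℂ (.nu a) - ι ℂ (.nu a) * ι ℂ (.an f)) ((2 : ℂ) • ι ℂ (.an (star a * f)))
  | cr_cr (f g : TestAlg d) : Rel c d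
      (ι ℂ (.cr f) * ι ℂ (.cr g) - ι ℂ (.cr g) * ι ℂ (.cr f)) 0
  | an_an (f g : TestAlg d) : Rel c d
      (ι ℂ (.an f) * ι ℂ (.an g) - ι ℂ (.an g) * ι ℂ (.an f)) 0
  | nu_nu (a b : TestAlg d) : Rel c d
      (ι ℂ (.nu a) * ι ℂ (.nu b) - ι ℂ (.nu b) * ι ℂ (.nu a)) 0

end relations

/-- The universal enveloping algebra of the renormalized square of white noise. -/
def RSWN (c : ℝ) (d : ℕ) : Type := RingQuot (Rel c d)

variable {c : ℝ}

noncomputable instance : Ring (RSWN c d) := inferInstanceAs (Ring (RingQuot (Rel c d)))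
noncomputable instance : Algebra ℂ (RSWN c d) :=
  inferInstanceAs (Algebra ℂ (RingQuot (Rel c d)))

/-- The canonical map from the free algebra. -/
noncomputable def RSWN.mk (c : ℝ) (d : ℕ) : FreeAlgebra ℂ (Gen d) →ₐ[ℂ] RSWN c d :=
  RingQuot.mkAlgHom ℂ (Rel c d)

/-- The creator `B⁺_f`. -/
noncomputable def cr (c : ℝ) (f : TestAlg d) : RSWN c d := RSWN.mk c d (FreeAlgebra.ι ℂ (.cr f))
/-- The annihilator `B_f`. -/
noncomputable def an (c : ℝ) (f : TestAlg d) : RSWN c d := RSWN.mk c d (FreeAlgebra.ι ℂ (.an f))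
/-- The number operator `N_f`. -/
noncomputable def nu (c : ℝ) (f : TestAlg d) : RSWN c d := RSWN.mk c d (FreeAlgebra.ι ℂ (.nu f))

theorem RSWN.rel {x y : FreeAlgebra ℂ (Gen d)} (h : Rel c d x y) :
    RSWN.mk c d x = RSWN.mk c d y := RingQuot.mkAlgHom_rel ℂ h

theorem cr_add (f g : TestAlg d) : cr c (f + g) = cr c f + cr c g := by
  simpa [cr] using RSWN.rel (Rel.cr_add (c := c) f g)
theorem cr_smul (z : ℂ) (f : TestAlg d) : cr c (z • f) = z • cr c f := by
  simpa [cr] using RSWN.rel (Rel.cr_smul (c := c) z f)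
theorem an_add (f g : TestAlg d) : an c (f + g) = an c f + an c g := by
  simpa [an] using RSWN.rel (Rel.an_add (c := c) f g)
theorem an_smul (z : ℂ) (f : TestAlg d) : an c (z • f) = conj z • an c f := by
  simpa [an] using RSWN.rel (Rel.an_smul (c := c) z f)
theorem nu_add (f g : TestAlg d) : nu c (f + g) = nu c f + nu c g := by
  simpa [nu] using RSWN.rel (Rel.nu_add (c := c) f g)
theorem nu_smul (z : ℂ) (f : TestAlg d) : nu c (z • f) = z • nu c f := by
  simpa [nu] using RSWN.rel (Rel.nu_smul (c := c) z f)
theorem an_cr (f g : TestAlg d) : an c f * cr c g - cr c g * an c f =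
    algebraMap ℂ _ (2 * c * l2inner f g) + (4 : ℂ) • nu c (star f * g) := by
  simpa [an, cr, nu] using RSWN.rel (Rel.an_cr (c := c) f g)
theorem nu_cr (a f : TestAlg d) : nu c a * cr c f - cr c f * nu c a =
    (2 : ℂ) • cr c (a * f) := by
  simpa [cr, nu] using RSWN.rel (Rel.nu_cr (c := c) a f)
theorem an_nu (a f : TestAlg d) : an c f * nu c a - nu c a * an c f =
    (2 : ℂ) • an c (star a * f) := by
  simpa [an, nu] using RSWN.rel (Rel.an_nu (c := c) a f)
theorem cr_cr (f g : TestAlg d) : cr c f * cr c g = cr c g * cr c f :=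
  sub_eq_zero.1 (by simpa [cr] using RSWN.rel (Rel.cr_cr (c := c) f g))
theorem an_an (f g : TestAlg d) : an c f * an c g = an c g * an c f :=
  sub_eq_zero.1 (by simpa [an] using RSWN.rel (Rel.an_an (c := c) f g))
theorem nu_nu (f g : TestAlg d) : nu c f * nu c g = nu c g * nu c f :=
  sub_eq_zero.1 (by simpa [nu] using RSWN.rel (Rel.nu_nu (c := c) f g))

/-- Induction along the generators. -/
theorem RSWN.induction {p : RSWN c d → Prop} (x : RSWN c d)
    (scalar : ∀ z : ℂ, p (algebraMap ℂ _ z)) (hcr : ∀ f, p (cr c f)) (han : ∀ f, p (an c f))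
    (hnu : ∀ f, p (nu c f)) (add : ∀ x y, p x → p y → p (x + y))
    (mul : ∀ x y, p x → p y → p (x * y)) : p x := by
  obtain ⟨x, rfl⟩ := RingQuot.mkAlgHom_surjective ℂ (Rel c d) x
  change p (RSWN.mk c d x)
  induction x using FreeAlgebra.induction with
  | grade0 z => simpa using scalar z
  | grade1 g => cases g with
    | cr f => exact hcr f
    | an f => exact han f
    | nu f => exact hnu f
  | mul x y hx hy => simpa using mul _ _ hx hy
  | add x y hx hy => simpa using add _ _ hx hy

/-- The opposite algebra with the conjugate scalar action. -/
def ConjOp (c : ℝ) (d : ℕ) : Type := (RSWN c d)ᵐᵒᵖ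

noncomputable instance : Ring (ConjOp c d) := inferInstanceAs (Ring (RSWN c d)ᵐᵒᵖ)
noncomputable instance : Algebra ℂ (ConjOp c d) :=
  RingHom.toAlgebra' ((algebraMap ℂ (RSWN c d)ᵐᵒᵖ).comp (starRingEnd ℂ)) fun z x =>
    Algebra.commutes (A := (RSWN c d)ᵐᵒᵖ) (conj z) x

/-- The identity map, into the opposite algebra. -/
def toConjOp (x : RSWN c d) : ConjOp c d := MulOpposite.op x
/-- The identity map, from the opposite algebra. -/
def ofConjOp (x : ConjOp c d) : RSWN c d := MulOpposite.unop x

theorem ofConjOp_mul (x y : ConjOp c d) : ofConjOp (x * y) = ofConjOp y * ofConjOp x := rfl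
theorem ofConjOp_add (x y : ConjOp c d) : ofConjOp (x + y) = ofConjOp x + ofConjOp y := rfl
theorem ofConjOp_sub (x y : ConjOp c d) : ofConjOp (x - y) = ofConjOp x - ofConjOp y := rfl
theorem ofConjOp_zero : ofConjOp (0 : ConjOp c d) = 0 := rfl
theorem ofConjOp_algebraMap (z : ℂ) :
    ofConjOp (algebraMap ℂ (ConjOp c d) z) = algebraMap ℂ _ (conj z) := rfl
theorem ofConjOp_smul (z : ℂ) (x : ConjOp c d) : ofConjOp (z • x) = conj z • ofConjOp x := by
  rw [Algebra.smul_def, ofConjOp_mul, ofConjOp_algebraMap, ← Algebra.commutes, ← Algebra.smul_def]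
theorem ofConjOp_injective : Function.Injective (ofConjOp : ConjOp c d → RSWN c d) :=
  MulOpposite.unop_injective

/-- The involution on generators. -/
noncomputable def starGen (c : ℝ) : Gen d → ConjOp c d
  | .cr f => toConjOp (an c f)
  | .an f => toConjOp (cr c f)
  | .nu f => toConjOp (nu c (star f))

/-- The involution as a homomorphism into the conjugate opposite algebra. -/
noncomputable def starHom (c : ℝ) (d : ℕ) : RSWN c d →ₐ[ℂ] ConjOp c d :=
  RingQuot.liftAlgHom ℂ ⟨FreeAlgebra.lift ℂ (starGen c), by
    have t (x : RSWN c d) : ofConjOp (toConjOp x) = x := rfl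
    intro x y h
    apply ofConjOp_injective
    cases h with
    | cr_add f g => simp [starGen, ofConjOp_add, t, an_add]
    | cr_smul z f => simp [starGen, ofConjOp_smul, t, an_smul]
    | an_add f g => simp [starGen, ofConjOp_add, t, cr_add]
    | an_smul z f => simp [starGen, ofConjOp_smul, t, cr_smul]
    | nu_add f g => simp [starGen, ofConjOp_add, t, nu_add]
    | nu_smul z f => simp [starGen, ofConjOp_smul, t, nu_smul]
    | an_cr f g =>
      have h := an_cr (c := c) g f
      rw [map_sub, map_mul, map_mul, map_add, AlgHom.commutes, map_smul]
      simp only [FreeAlgebra.lift_ι_apply, starGen, ofConjOp_sub, ofConjOp_mul, ofConjOp_add,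
        ofConjOp_algebraMap, ofConjOp_smul, t]
      rw [h]
      simp only [map_mul, l2inner_conj, star_mul, star_star, Complex.conj_ofReal, Complex.conj_ofNat]
    | nu_cr a f =>
      have h := an_nu (c := c) (star a) f
      simp only [map_sub, map_mul, map_smul, FreeAlgebra.lift_ι_apply, starGen, ofConjOp_sub,
        ofConjOp_mul, ofConjOp_smul, t, h, star_star, Complex.conj_ofNat]
    | an_nu a f =>
      have h := nu_cr (c := c) (star a) f
      simp only [map_sub, map_mul, map_smul, FreeAlgebra.lift_ι_apply, starGen, ofConjOp_sub,
        ofConjOp_mul, ofConjOp_smul, t, h, star_star, Complex.conj_ofNat]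
    | cr_cr f g => simp [starGen, ofConjOp_sub, ofConjOp_mul, t, an_an g f, ofConjOp_zero]
    | an_an f g => simp [starGen, ofConjOp_sub, ofConjOp_mul, t, cr_cr g f, ofConjOp_zero]
    | nu_nu f g => simp [starGen, ofConjOp_sub, ofConjOp_mul, t, nu_nu (star g) (star f),
        ofConjOp_zero]⟩

/-- The involution, determined by `(B⁺_f)* = B_f`, `(N_f)* = N_{conj f}`. -/
noncomputable instance : Star (RSWN c d) := ⟨fun x => ofConjOp (starHom c d x)⟩

theorem star_def' (x : RSWN c d) : star x = ofConjOp (starHom c d x) := rfl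

theorem starHom_mk (x : FreeAlgebra ℂ (Gen d)) :
    starHom c d (RSWN.mk c d x) = FreeAlgebra.lift ℂ (starGen c) x :=
  RingQuot.liftAlgHom_mkAlgHom_apply ℂ _ _ _

theorem star_cr (f : TestAlg d) : star (cr c f) = an c f := by
  rw [star_def', cr, starHom_mk, FreeAlgebra.lift_ι_apply]; rfl
theorem star_an (f : TestAlg d) : star (an c f) = cr c f := by
  rw [star_def', an, starHom_mk, FreeAlgebra.lift_ι_apply]; rfl
theorem star_nu (f : TestAlg d) : star (nu c f) = nu c (star f) := by
  rw [star_def', nu, starHom_mk, FreeAlgebra.lift_ι_apply]; rfl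

theorem star_mul_aux (x y : RSWN c d) : star (x * y) = star y * star x := by
  simp only [star_def', map_mul, ofConjOp_mul]
theorem star_add_aux (x y : RSWN c d) : star (x + y) = star x + star y := by
  simp only [star_def', map_add, ofConjOp_add]
theorem star_alg_aux (z : ℂ) :
    star (algebraMap ℂ (RSWN c d) z) = algebraMap ℂ _ (conj z) := by
  rw [star_def', AlgHom.commutes, ofConjOp_algebraMap]

noncomputable instance : StarRing (RSWN c d) where
  star_involutive x := by
    induction x using RSWN.induction with
    | scalar z => rw [star_alg_aux, star_alg_aux, Complex.conj_conj]
    | hcr f => rw [star_cr, star_an]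
    | han f => rw [star_an, star_cr]
    | hnu f => rw [star_nu, star_nu, star_star]
    | add x y hx hy => rw [star_add_aux, star_add_aux, hx, hy]
    | mul x y hx hy => rw [star_mul_aux, star_mul_aux, hx, hy]
  star_mul := star_mul_aux
  star_add := star_add_aux

instance : StarModule ℂ (RSWN c d) where
  star_smul z x := by
    rw [Algebra.smul_def, star_mul, star_alg_aux, ← Algebra.commutes, ← Algebra.smul_def]; rfl


/-- The quadratic Fock state: a state on the `*`-algebra with `φ(x B_g) = φ(x N_g) = 0`. -/
structure IsFockState (φ : RSWN c d →ₗ[ℂ] ℂ) : Prop where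
  map_one : φ 1 = 1
  nonneg (x : RSWN c d) : 0 ≤ φ (star x * x)
  mul_an (x : RSWN c d) (g : TestAlg d) : φ (x * an c g) = 0
  mul_nu (x : RSWN c d) (g : TestAlg d) : φ (x * nu c g) = 0

/-! ### Existence and uniqueness of the Fock state: a module over the algebra -/

namespace Model
open MvPolynomial Module

/-- Index set of a basis of the test function algebra. -/
abbrev Ix (d : ℕ) : Type := Basis.ofVectorSpaceIndex ℂ (TestAlg d)

/-- Polynomials in the functions `h ↦ ∫ b h^(k+1)` with `b` in a basis. -/
abbrev Pol (d : ℕ) : Type := MvPolynomial (ℕ × Ix d) ℂ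

/-- A basis. -/
noncomputable def bas (d : ℕ) : Basis (Ix d) ℂ (TestAlg d) := Basis.ofVectorSpace ℂ (TestAlg d)

/-- The function `h ↦ ∫ u h^(k+1)`. -/
noncomputable def mom (k : ℕ) : TestAlg d →ₗ[ℂ] Pol d := (bas d).constr ℂ fun i => X (k, i)

theorem mom_bas (k : ℕ) (i : Ix d) : mom k (bas d i) = X (k, i) := by simp [mom]

/-- Two derivations that agree on the moments are equal. -/
theorem der_ext {D D' : Derivation ℂ (Pol d) (Pol d)}
    (h : ∀ k u, D (mom k u) = D' (mom k u)) : D = D' :=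
  derivation_ext fun ⟨k, i⟩ => by simpa [mom_bas] using h k (bas d i)

/-- A derivation with given values on the moments. -/
noncomputable def der (v : ℕ → TestAlg d →ₗ[ℂ] Pol d) : Derivation ℂ (Pol d) (Pol d) :=
  mkDerivation ℂ fun p => v p.1 (bas d p.2)

theorem der_mom (v : ℕ → TestAlg d →ₗ[ℂ] Pol d) (k : ℕ) (u : TestAlg d) :
    der v (mom k u) = v k u := by
  have : (der v).toLinearMap ∘ₗ mom k = v k := (bas d).ext fun i => by
    simp [mom_bas, der, mkDerivation_X]
  exact LinearMap.congr_fun this u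

/-- Multiplication by a test function. -/
noncomputable def mulL (f : TestAlg d) : TestAlg d →ₗ[ℂ] TestAlg d := LinearMap.mulLeft ℂ f

theorem mulL_apply (f g : TestAlg d) : mulL f g = f * g := rfl

/-- The functional `g ↦ ⟨f, g⟩`. -/
noncomputable def pairL (f : TestAlg d) : TestAlg d →ₗ[ℂ] ℂ where
  toFun g := l2inner f g
  map_add' := l2inner_add_right f
  map_smul' z g := l2inner_smul_right z f g

theorem pairL_apply (f g : TestAlg d) : pairL f g = l2inner f g := rfl

/-- Values of the derivative in the constant direction `conj f`. -/
noncomputable def anV (f : TestAlg d) : ℕ → TestAlg d →ₗ[ℂ] Pol d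
  | 0 => Algebra.linearMap ℂ (Pol d) ∘ₗ pairL f
  | k + 1 => ((k : ℂ) + 2) • (mom k ∘ₗ mulL (star f))

/-- The derivative in the constant direction `conj f`. -/
noncomputable def anD (f : TestAlg d) : Derivation ℂ (Pol d) (Pol d) := der (anV f)
/-- The derivative along `h ↦ 2 a h`. -/
noncomputable def nuD (a : TestAlg d) : Derivation ℂ (Pol d) (Pol d) :=
  der fun k => (2 * ((k : ℂ) + 1)) • (mom k ∘ₗ mulL a)
/-- The derivative along `h ↦ 4 g h²`. -/
noncomputable def crD (g : TestAlg d) : Derivation ℂ (Pol d) (Pol d) :=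
  der fun k => (4 * ((k : ℂ) + 1)) • (mom (k + 1) ∘ₗ mulL g)

theorem anD_zero (f u : TestAlg d) : anD f (mom 0 u) = algebraMap ℂ _ (l2inner f u) := by
  rw [anD, der_mom]; rfl
theorem anD_succ (f u : TestAlg d) (k : ℕ) :
    anD f (mom (k + 1) u) = ((k : ℂ) + 2) • mom k (star f * u) := by
  rw [anD, der_mom]; rfl
theorem nuD_mom (f u : TestAlg d) (k : ℕ) :
    nuD f (mom k u) = (2 * ((k : ℂ) + 1)) • mom k (f * u) := by
  rw [nuD, der_mom]; rfl
theorem crD_mom (f u : TestAlg d) (k : ℕ) :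
    crD f (mom k u) = (4 * ((k : ℂ) + 1)) • mom (k + 1) (f * u) := by
  rw [crD, der_mom]; rfl

theorem l2inner_add_left (f g h : TestAlg d) : l2inner (f + g) h = l2inner f h + l2inner g h := by
  rw [← l2inner_conj, l2inner_add_right, map_add, l2inner_conj, l2inner_conj]
theorem l2inner_smul_left (z : ℂ) (f g : TestAlg d) :
    l2inner (z • f) g = conj z * l2inner f g := by
  rw [← l2inner_conj, l2inner_smul_right, map_mul, l2inner_conj]

/-- The operator `B⁺_g`. -/
noncomputable def crE (c : ℝ) (g : TestAlg d) : End ℂ (Pol d) :=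
  (2 * (c : ℂ)) • LinearMap.mulLeft ℂ (mom 0 g) + (crD g).toLinearMap

theorem crE_apply (g : TestAlg d) (p : Pol d) :
    crE c g p = (2 * (c : ℂ)) • (mom 0 g * p) + crD g p := rfl

/-- The operators of the generators. -/
noncomputable def genE (c : ℝ) : Gen d → End ℂ (Pol d)
  | .cr f => crE c f
  | .an f => (anD f).toLinearMap
  | .nu f => (nuD f).toLinearMap

theorem anD_add (f g : TestAlg d) : anD (f + g) = anD f + anD g := der_ext fun k u => by
  cases k with
  | zero => simp [anD_zero, l2inner_add_left, -algebraMap_eq]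
  | succ k => simp [anD_succ, add_mul]
theorem anD_smul (z : ℂ) (f : TestAlg d) : anD (z • f) = conj z • anD f := der_ext fun k u => by
  cases k with
  | zero => 
    simp only [anD_zero, l2inner_smul_left, Derivation.smul_apply, map_mul, Algebra.smul_def]
  | succ k => 
    simp only [anD_succ, star_smul, smul_mul_assoc, map_smul, Derivation.smul_apply]
    rw [smul_comm]; rfl
theorem nuD_add (f g : TestAlg d) : nuD (f + g) = nuD f + nuD g := der_ext fun k u => by
  simp [nuD_mom, add_mul]
theorem nuD_smul (z : ℂ) (f : TestAlg d) : nuD (z • f) = z • nuD f := der_ext fun k u => by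
  simp only [nuD_mom, smul_mul_assoc, map_smul, Derivation.smul_apply]
  rw [smul_comm]
theorem crD_add (f g : TestAlg d) : crD (f + g) = crD f + crD g := der_ext fun k u => by
  simp [crD_mom, add_mul]
theorem crD_smul (z : ℂ) (f : TestAlg d) : crD (z • f) = z • crD f := der_ext fun k u => by
  simp only [crD_mom, smul_mul_assoc, map_smul, Derivation.smul_apply]
  rw [smul_comm]

theorem anD_crD (f g : TestAlg d) : ⁅anD f, crD g⁆ = (4 : ℂ) • nuD (star f * g) :=
  der_ext fun k u => by
  cases k with
  | zero =>
    simp only [Derivation.commutator_apply, crD_mom, Derivation.map_smul, anD_zero, anD_succ, nuD_mom,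
      Derivation.smul_apply, Derivation.map_algebraMap, mul_assoc]
    module
  | succ k =>
    simp only [Derivation.commutator_apply, crD_mom, Derivation.map_smul, anD_succ, nuD_mom,
      Derivation.smul_apply, mul_assoc, mul_left_comm g (star f) u]
    push_cast
    module

theorem nuD_crD (f g : TestAlg d) : ⁅nuD f, crD g⁆ = (2 : ℂ) • crD (f * g) :=
  der_ext fun k u => by
    simp only [Derivation.commutator_apply, crD_mom, Derivation.map_smul, nuD_mom,
      Derivation.smul_apply, mul_assoc, mul_left_comm g f u]
    push_cast
    module

theorem anD_nuD (f g : TestAlg d) : ⁅anD f, nuD g⁆ = (2 : ℂ) • anD (star g * f) :=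
  der_ext fun k u => by
  cases k with
  | zero =>
    have : l2inner f (g * u) = l2inner (star g * f) u := by
      rw [mul_comm (star g), l2inner_mul_left, star_star]
    simp only [Derivation.commutator_apply, Derivation.map_smul, anD_zero, nuD_mom,
      Derivation.smul_apply, Derivation.map_algebraMap, this]
    module
  | succ k =>
    simp only [Derivation.commutator_apply, Derivation.map_smul, anD_succ, nuD_mom,
      Derivation.smul_apply, star_mul, star_star, mul_assoc, mul_left_comm g (star f) u]
    push_cast
    module

theorem crD_crD (f g : TestAlg d) : ⁅crD f, crD g⁆ = 0 :=
  der_ext fun k u => by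
    simp only [Derivation.commutator_apply, crD_mom, Derivation.map_smul,
      Derivation.zero_apply, mul_left_comm g f u]
    push_cast
    module

theorem nuD_nuD (f g : TestAlg d) : ⁅nuD f, nuD g⁆ = 0 :=
  der_ext fun k u => by
    simp only [Derivation.commutator_apply, nuD_mom, Derivation.map_smul,
      Derivation.zero_apply, mul_left_comm g f u]
    module

theorem anD_anD (f g : TestAlg d) : ⁅anD f, anD g⁆ = 0 :=
  der_ext fun k u => by
    cases k with
    | zero => simp only [Derivation.commutator_apply, anD_zero, Derivation.map_algebraMap,
        Derivation.zero_apply, sub_zero]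
    | succ k =>
      cases k with
      | zero =>
        have : l2inner f (star g * u) = l2inner g (star f * u) := by
          rw [← l2inner_mul_left, ← l2inner_mul_left, mul_comm]
        simp only [Derivation.commutator_apply, anD_succ, anD_zero, Derivation.map_smul,
          Derivation.zero_apply, this]
        module
      | succ k =>
        simp only [Derivation.commutator_apply, anD_succ, Derivation.map_smul,
          Derivation.zero_apply, mul_left_comm (star g) (star f) u]
        module

/-- The representation on polynomials. -/
noncomputable def rep (c : ℝ) (d : ℕ) : RSWN c d →ₐ[ℂ] End ℂ (Pol d) :=
  RingQuot.liftAlgHom ℂ ⟨FreeAlgebra.lift ℂ (genE c), by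
    have com (D D' : Derivation ℂ (Pol d) (Pol d)) (p : Pol d) : D (D' p) - D' (D p) = ⁅D, D'⁆ p :=
      (Derivation.commutator_apply (D1 := D) (D2 := D') (a := p)).symm
    intro x y h
    refine LinearMap.ext fun p => ?_
    cases h with
    | cr_add f g =>
      simp only [map_add, FreeAlgebra.lift_ι_apply, genE, LinearMap.add_apply, crE_apply, crD_add,
        add_mul, Derivation.add_apply]
      module
    | cr_smul z f =>
      simp only [map_smul, Derivation.map_smul, FreeAlgebra.lift_ι_apply, genE, LinearMap.smul_apply, crE_apply,
        crD_smul, smul_mul_assoc, Derivation.smul_apply]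
      module
    | an_add f g => simp [genE, anD_add]
    | an_smul z f =>
      simp only [map_smul, Derivation.map_smul, FreeAlgebra.lift_ι_apply, genE, LinearMap.smul_apply, anD_smul]; rfl
    | nu_add f g => simp [genE, nuD_add]
    | nu_smul z f =>
      simp only [map_smul, Derivation.map_smul, FreeAlgebra.lift_ι_apply, genE, LinearMap.smul_apply, nuD_smul]; rfl
    | an_cr f g =>
      have h := com (anD f) (crD g) p
      rw [anD_crD] at h
      simp only [map_sub, map_mul, map_add, map_smul, Derivation.map_smul, FreeAlgebra.lift_ι_apply, genE,
        LinearMap.sub_apply, LinearMap.add_apply, LinearMap.smul_apply, Module.End.mul_apply,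
        crE_apply, Derivation.coeFn_coe, Derivation.leibniz, anD_zero, AlgHom.commutes,
        Module.algebraMap_end_apply, Derivation.smul_apply, smul_eq_mul] at h ⊢
      rw [← h, mul_comm p, ← Algebra.smul_def]
      module
    | nu_cr a f =>
      have h := com (nuD a) (crD f) p
      rw [nuD_crD] at h
      simp only [map_sub, map_mul, map_add, map_smul, Derivation.map_smul, FreeAlgebra.lift_ι_apply, genE,
        LinearMap.sub_apply, LinearMap.add_apply, LinearMap.smul_apply, Module.End.mul_apply,
        crE_apply, Derivation.coeFn_coe, Derivation.leibniz, nuD_mom,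
        Derivation.smul_apply, smul_eq_mul, smul_add] at h ⊢
      rw [← h, mul_comm p, smul_mul_assoc]
      push_cast
      module
    | an_nu a f =>
      have h := com (anD f) (nuD a) p
      rw [anD_nuD] at h
      simpa [genE] using h
    | cr_cr f g =>
      have h := com (crD f) (crD g) p
      rw [crD_crD] at h
      simp only [map_sub, map_mul, map_add, map_smul, Derivation.map_smul, FreeAlgebra.lift_ι_apply, genE,
        LinearMap.sub_apply, Module.End.mul_apply, map_zero, LinearMap.zero_apply,
        crE_apply, Derivation.leibniz, crD_mom, Derivation.zero_apply,
        smul_eq_mul, mul_add, mul_smul_comm] at h ⊢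
      rw [mul_left_comm (mom 0 f), mul_comm f g, sub_eq_zero.1 h]
      module
    | an_an f g =>
      have h := com (anD f) (anD g) p
      rw [anD_anD] at h
      simpa [genE] using h
    | nu_nu f g =>
      have h := com (nuD f) (nuD g) p
      rw [nuD_nuD] at h
      simpa [genE] using h⟩

theorem rep_mk (x : FreeAlgebra ℂ (Gen d)) :
    rep c d (RSWN.mk c d x) = FreeAlgebra.lift ℂ (genE c) x :=
  RingQuot.liftAlgHom_mkAlgHom_apply ℂ _ _ _

theorem rep_cr (f : TestAlg d) : rep c d (cr c f) = crE c f := by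
  rw [cr, rep_mk, FreeAlgebra.lift_ι_apply]; rfl
theorem rep_an (f : TestAlg d) : rep c d (an c f) = (anD f).toLinearMap := by
  rw [an, rep_mk, FreeAlgebra.lift_ι_apply]; rfl
theorem rep_nu (f : TestAlg d) : rep c d (nu c f) = (nuD f).toLinearMap := by
  rw [nu, rep_mk, FreeAlgebra.lift_ι_apply]; rfl

/-- The functional `x ↦ (x · 1)(0)`. -/
noncomputable def vac (c : ℝ) (d : ℕ) : RSWN c d →ₗ[ℂ] ℂ where
  toFun x := constantCoeff (rep c d x 1)
  map_add' x y := by simp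
  map_smul' z x := by simp [smul_eq_C_mul]

theorem vac_apply (x : RSWN c d) : vac c d x = constantCoeff (rep c d x 1) := rfl

theorem vac_one : vac c d 1 = 1 := by simp [vac_apply]
theorem vac_mul_an (x : RSWN c d) (f : TestAlg d) : vac c d (x * an c f) = 0 := by
  simp [vac_apply, rep_an]
theorem vac_mul_nu (x : RSWN c d) (f : TestAlg d) : vac c d (x * nu c f) = 0 := by
  simp [vac_apply, rep_nu]

theorem constantCoeff_mom (k : ℕ) (u : TestAlg d) : constantCoeff (mom k u) = 0 := by
  have : (aeval (fun _ => (0 : ℂ)) : Pol d →ₐ[ℂ] ℂ).toLinearMap ∘ₗ mom k = 0 :=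
    (bas d).ext fun i => by simp [mom_bas]
  have h := LinearMap.congr_fun this u
  rwa [LinearMap.comp_apply, AlgHom.toLinearMap_apply, aeval_zero'] at h

theorem constantCoeff_crD (f : TestAlg d) (p : Pol d) : constantCoeff (crD f p) = 0 := by
  induction p using MvPolynomial.induction_on with
  | C a => simp [← algebraMap_eq]
  | add p q hp hq => simp [hp, hq]
  | mul_X p i hp =>
    rw [Derivation.leibniz, ← mom_bas, crD_mom]
    simp [hp, constantCoeff_mom, smul_eq_C_mul]

theorem constantCoeff_nuD (f : TestAlg d) (p : Pol d) : constantCoeff (nuD f p) = 0 := by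
  induction p using MvPolynomial.induction_on with
  | C a => simp [← algebraMap_eq]
  | add p q hp hq => simp [hp, hq]
  | mul_X p i hp =>
    rw [Derivation.leibniz, ← mom_bas, nuD_mom]
    simp [hp, constantCoeff_mom, smul_eq_C_mul]

theorem vac_nu_mul (x : RSWN c d) (f : TestAlg d) : vac c d (nu c f * x) = 0 := by
  simp [vac_apply, rep_nu, constantCoeff_nuD]

theorem vac_cr_mul (x : RSWN c d) (f : TestAlg d) : vac c d (cr c f * x) = 0 := by
  simp [vac_apply, rep_cr, crE_apply, constantCoeff_crD, constantCoeff_mom, smul_eq_C_mul]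

end Model

/-! ### Normal ordering -/

/-- The span of the elements `x B_g` and `x N_g`. -/
noncomputable def killed (c : ℝ) (d : ℕ) : Submodule ℂ (RSWN c d) :=
  Submodule.span ℂ ({y | ∃ x g, y = x * an c g} ∪ {y | ∃ x g, y = x * nu c g})

/-- The span of the products of `n` creators. -/
noncomputable def words (c : ℝ) (d : ℕ) (n : ℕ) : Submodule ℂ (RSWN c d) :=
  Submodule.span ℂ {y | ∃ l : List (TestAlg d), l.length = n ∧ y = (l.map (cr c)).prod}

theorem mul_an_mem (x : RSWN c d) (g : TestAlg d) : x * an c g ∈ killed c d :=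
  Submodule.subset_span (Or.inl ⟨x, g, rfl⟩)
theorem mul_nu_mem (x : RSWN c d) (g : TestAlg d) : x * nu c g ∈ killed c d :=
  Submodule.subset_span (Or.inr ⟨x, g, rfl⟩)

theorem mul_mem_killed (x : RSWN c d) {y : RSWN c d} (hy : y ∈ killed c d) :
    x * y ∈ killed c d := by
  induction hy using Submodule.span_induction with
  | mem y hy =>
    obtain ⟨z, g, rfl⟩ | ⟨z, g, rfl⟩ := hy
    · rw [← mul_assoc]; exact mul_an_mem _ _
    · rw [← mul_assoc]; exact mul_nu_mem _ _
  | zero => simp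
  | add y z _ _ hy hz => rw [mul_add]; exact add_mem hy hz
  | smul a y _ hy => rw [mul_smul_comm]; exact Submodule.smul_mem _ _ hy

theorem list_mem_words (l : List (TestAlg d)) : (l.map (cr c)).prod ∈ words c d l.length :=
  Submodule.subset_span ⟨l, rfl, rfl⟩

theorem cr_mul_words (f : TestAlg d) {n : ℕ} {y : RSWN c d} (hy : y ∈ words c d n) :
    cr c f * y ∈ words c d (n + 1) := by
  induction hy using Submodule.span_induction with
  | mem y hy =>
    obtain ⟨l, rfl, rfl⟩ := hy
    simpa using list_mem_words (c := c) (f :: l)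
  | zero => simp
  | add y z _ _ hy hz => rw [mul_add]; exact add_mem hy hz
  | smul a y _ hy => rw [mul_smul_comm]; exact Submodule.smul_mem _ _ hy

theorem cr_mul_sup (f : TestAlg d) {n : ℕ} {y : RSWN c d} (hy : y ∈ words c d n ⊔ killed c d) :
    cr c f * y ∈ words c d (n + 1) ⊔ killed c d := by
  obtain ⟨u, hu, v, hv, rfl⟩ := Submodule.mem_sup.1 hy
  rw [mul_add]
  exact Submodule.add_mem_sup (cr_mul_words f hu) (mul_mem_killed _ hv)

theorem nu_mul_list (a : TestAlg d) (l : List (TestAlg d)) :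
    nu c a * (l.map (cr c)).prod ∈ words c d l.length ⊔ killed c d := by
  induction l with
  | nil => simpa using Submodule.mem_sup_right (by simpa using mul_nu_mem (1 : RSWN c d) a)
  | cons f l ih =>
    have h := nu_cr (c := c) a f
    rw [sub_eq_iff_eq_add] at h
    rw [List.map_cons, List.prod_cons, ← mul_assoc, h, add_mul, smul_mul_assoc, mul_assoc]
    refine add_mem (Submodule.smul_mem _ _ (Submodule.mem_sup_left ?_)) (cr_mul_sup _ ih)
    exact cr_mul_words _ (list_mem_words l)

theorem an_mul_list (f : TestAlg d) (l : List (TestAlg d)) :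
    an c f * (l.map (cr c)).prod ∈
      (match l.length with
        | 0 => ⊥
        | n + 1 => words c d n) ⊔ killed c d := by
  induction l with
  | nil => simpa using mul_an_mem (1 : RSWN c d) f
  | cons g l ih =>
    have h := an_cr (c := c) f g
    rw [sub_eq_iff_eq_add] at h
    rw [List.map_cons, List.prod_cons, ← mul_assoc, h, add_mul, add_mul, smul_mul_assoc,
      mul_assoc (cr c g), ← Algebra.smul_def]
    refine add_mem (add_mem (Submodule.smul_mem _ _ (Submodule.mem_sup_left (list_mem_words l)))
      (Submodule.smul_mem _ _ (nu_mul_list _ l))) ?_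
    cases l with
    | nil => exact Submodule.mem_sup_right (mul_mem_killed _ (by simpa using mul_an_mem (1 : RSWN c d) f))
    | cons h l => exact cr_mul_sup _ ih

theorem nu_mul_sup (f : TestAlg d) {n : ℕ} {y : RSWN c d} (hy : y ∈ words c d n ⊔ killed c d) :
    nu c f * y ∈ words c d n ⊔ killed c d := by
  obtain ⟨u, hu, v, hv, rfl⟩ := Submodule.mem_sup.1 hy
  rw [mul_add]
  refine add_mem ?_ (Submodule.mem_sup_right (mul_mem_killed _ hv))
  clear hy
  induction hu using Submodule.span_induction with
  | mem y hy => obtain ⟨l, rfl, rfl⟩ := hy; exact nu_mul_list _ _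
  | zero => simp
  | add y z _ _ hy hz => rw [mul_add]; exact add_mem hy hz
  | smul a y _ hy => rw [mul_smul_comm]; exact Submodule.smul_mem _ _ hy

theorem an_mul_sup_succ (f : TestAlg d) {n : ℕ} {y : RSWN c d}
    (hy : y ∈ words c d (n + 1) ⊔ killed c d) : an c f * y ∈ words c d n ⊔ killed c d := by
  obtain ⟨u, hu, v, hv, rfl⟩ := Submodule.mem_sup.1 hy
  rw [mul_add]
  refine add_mem ?_ (Submodule.mem_sup_right (mul_mem_killed _ hv))
  clear hy
  induction hu using Submodule.span_induction with
  | mem y hy =>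
    obtain ⟨l, hl, rfl⟩ := hy
    have := an_mul_list (c := c) f l
    rwa [hl] at this
  | zero => simp
  | add y z _ _ hy hz => rw [mul_add]; exact add_mem hy hz
  | smul a y _ hy => rw [mul_smul_comm]; exact Submodule.smul_mem _ _ hy

theorem words_zero : words c d 0 = Submodule.span ℂ {1} := by
  refine congrArg (Submodule.span ℂ) (Set.ext fun y => ⟨?_, ?_⟩)
  · rintro ⟨l, hl, rfl⟩
    rw [List.length_eq_zero_iff.1 hl]; simp
  · rintro rfl
    exact ⟨[], rfl, by simp⟩

theorem an_mul_sup_zero (f : TestAlg d) {y : RSWN c d}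
    (hy : y ∈ words c d 0 ⊔ killed c d) : an c f * y ∈ killed c d := by
  obtain ⟨u, hu, v, hv, rfl⟩ := Submodule.mem_sup.1 hy
  rw [mul_add]
  refine add_mem ?_ (mul_mem_killed _ hv)
  rw [words_zero] at hu
  obtain ⟨z, rfl⟩ := Submodule.mem_span_singleton.1 hu
  rw [mul_smul_comm, mul_one]
  exact Submodule.smul_mem _ _ (by simpa using mul_an_mem (1 : RSWN c d) f)

/-- Normal ordering. -/
theorem mem_sup_words (x : RSWN c d) : x ∈ (⨆ n, words c d n) ⊔ killed c d := by
  suffices h : ∀ y ∈ (⨆ n, words c d n) ⊔ killed c d, x * y ∈ (⨆ n, words c d n) ⊔ killed c d by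
    have h1 : (1 : RSWN c d) ∈ words c d 0 := by
      rw [words_zero]; exact Submodule.subset_span rfl
    simpa using h 1 (Submodule.mem_sup_left (Submodule.mem_iSup_of_mem 0 h1))
  have key (z : RSWN c d)
      (hz : ∀ n, ∀ y ∈ words c d n, z * y ∈ (⨆ n, words c d n) ⊔ killed c d) :
      ∀ y ∈ (⨆ n, words c d n) ⊔ killed c d, z * y ∈ (⨆ n, words c d n) ⊔ killed c d := by
    intro y hy
    obtain ⟨u, hu, v, hv, rfl⟩ := Submodule.mem_sup.1 hy
    rw [mul_add]
    refine add_mem ?_ (Submodule.mem_sup_right (mul_mem_killed _ hv))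
    clear hy
    induction hu using Submodule.iSup_induction' with
    | mem n y hy => exact hz n y hy
    | zero => simp
    | add y w _ _ hy hw => rw [mul_add]; exact add_mem hy hw
  have le (n : ℕ) : words c d n ⊔ killed c d ≤ (⨆ n, words c d n) ⊔ killed c d :=
    sup_le_sup_right (le_iSup _ n) _
  induction x using RSWN.induction with
  | scalar z => intro y hy; rw [← Algebra.smul_def]; exact Submodule.smul_mem _ _ hy
  | hcr f =>
    exact key _ fun n y hy => le (n + 1) (Submodule.mem_sup_left (cr_mul_words f hy))
  | hnu f => exact key _ fun n y hy => le n (nu_mul_sup f (Submodule.mem_sup_left hy))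
  | han f =>
    refine key _ fun n y hy => ?_
    cases n with
    | zero => exact Submodule.mem_sup_right (an_mul_sup_zero f (Submodule.mem_sup_left hy))
    | succ n => exact le n (an_mul_sup_succ f (Submodule.mem_sup_left hy))
  | add x y hx hy => intro z hz; rw [add_mul]; exact add_mem (hx z hz) (hy z hz)
  | mul x y hx hy => intro z hz; rw [mul_assoc]; exact hx _ (hy z hz)

/-- A functional that vanishes on `x B_g`, `x N_g` and `B⁺_g x` is determined by its value at
the unit. -/
theorem functional_ext {φ ψ : RSWN c d →+ ℂ} (hφ : ∀ z x, φ (z • x) = z * φ x)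
    (hψ : ∀ z x, ψ (z • x) = z * ψ x) (h1 : φ 1 = ψ 1)
    (han : ∀ x g, φ (x * an c g) = ψ (x * an c g)) (hnu : ∀ x g, φ (x * nu c g) = ψ (x * nu c g))
    (hcr : ∀ x g, φ (cr c g * x) = ψ (cr c g * x)) : φ = ψ := by
  ext x
  let Φ : RSWN c d →ₗ[ℂ] ℂ := { φ with map_smul' := hφ }
  let Ψ : RSWN c d →ₗ[ℂ] ℂ := { ψ with map_smul' := hψ }
  have hk : killed c d ≤ LinearMap.eqLocus Φ Ψ := by
    refine Submodule.span_le.2 ?_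
    rintro _ (⟨x, g, rfl⟩ | ⟨x, g, rfl⟩)
    · exact han x g
    · exact hnu x g
  have hw (n : ℕ) : words c d n ≤ LinearMap.eqLocus Φ Ψ := by
    refine Submodule.span_le.2 ?_
    rintro _ ⟨l, -, rfl⟩
    cases l with
    | nil => exact h1
    | cons f l => exact hcr _ f
  exact sup_le (iSup_le hw) hk (mem_sup_words x)

theorem IsFockState.star {φ : RSWN c d →ₗ[ℂ] ℂ} (h : IsFockState φ) (x : RSWN c d) :
    φ (Star.star x) = conj (φ x) := by
  have h1 := h.nonneg (1 + x)
  have h2 := h.nonneg (1 + Complex.I • x)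
  have h3 := h.nonneg x
  simp only [star_add, star_one, star_smul, mul_add, add_mul, one_mul, mul_one, map_add, map_smul,
    smul_mul_assoc, mul_smul_comm, h.map_one, smul_eq_mul, Complex.star_def, Complex.conj_I] at h1 h2
  have e1 := (Complex.nonneg_iff.1 h1).2
  have e2 := (Complex.nonneg_iff.1 h2).2
  have e3 := (Complex.nonneg_iff.1 h3).2
  simp at e1 e2 e3
  apply Complex.ext
  · simp; linarith
  · simp; linarith

theorem IsFockState.cr_mul {φ : RSWN c d →ₗ[ℂ] ℂ} (h : IsFockState φ) (x : RSWN c d)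
    (g : TestAlg d) : φ (cr c g * x) = 0 := by
  have := h.star (Star.star x * an c g)
  rw [h.mul_an, star_mul, star_star, star_an, map_zero] at this
  exact this

theorem IsFockState.unique {φ ψ : RSWN c d →ₗ[ℂ] ℂ} (hφ : IsFockState φ) (hψ : IsFockState ψ) :
    φ = ψ := by
  have := functional_ext (φ := φ.toAddMonoidHom) (ψ := ψ.toAddMonoidHom) (fun z x => by simp)
    (fun z x => by simp) (by simp [hφ.map_one, hψ.map_one])
    (fun x g => by simp [hφ.mul_an, hψ.mul_an]) (fun x g => by simp [hφ.mul_nu, hψ.mul_nu])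
    (fun x g => by simp [hφ.cr_mul, hψ.cr_mul])
  ext x
  exact DFunLike.congr_fun this x

open Model in
theorem vac_star (x : RSWN c d) : vac c d (star x) = conj (vac c d x) := by
  let ψ : RSWN c d →+ ℂ :=
    { toFun x := conj (vac c d (star x)), map_zero' := by simp, map_add' x y := by simp }
  have := functional_ext (φ := (vac c d).toAddMonoidHom) (ψ := ψ) (fun z x => by simp)
    (fun z x => by simp [ψ]) (by simp [ψ, vac_one])
    (fun x g => by simp [ψ, vac_mul_an, star_an, vac_cr_mul])
    (fun x g => by
      simp [ψ, vac_mul_nu, star_nu, vac_nu_mul])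
    (fun x g => by simp [ψ, vac_cr_mul, star_cr, vac_mul_an])
  have h := DFunLike.congr_fun this x
  change vac c d x = conj (vac c d (star x)) at h
  rw [h, Complex.conj_conj]

/-! ### Positivity -/

/-- The span of the powers `(B⁺_f)ⁿ`. -/
noncomputable def powers (c : ℝ) (d : ℕ) (n : ℕ) : Submodule ℂ (RSWN c d) :=
  Submodule.span ℂ (Set.range fun f : TestAlg d => cr c f ^ n)

theorem coeff_mem {M : Type*} [AddCommGroup M] [Module ℂ M] (V : Submodule ℂ M) (N : ℕ)
    (v : ℕ → M) (h : ∀ t : ℂ, ∑ j ∈ Finset.range N, t ^ j • v j ∈ V) (j : ℕ) (hj : j < N) :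
    v j ∈ V := by
  by_contra hv
  obtain ⟨f, hf, hV⟩ := Submodule.exists_le_ker_of_notMem hv
  let p : Polynomial ℂ := ∑ j ∈ Finset.range N, Polynomial.monomial j (f (v j))
  have hp : p = 0 := Polynomial.funext fun t => by
    have := hV (h t)
    rw [LinearMap.mem_ker, map_sum] at this
    rw [Polynomial.eval_zero, ← this, Polynomial.eval_finsetSum]
    exact Finset.sum_congr rfl fun j _ => by simp [mul_comm]
  apply hf
  have : p.coeff j = f (v j) := by
    simp [p, Polynomial.finsetSum_coeff, Polynomial.coeff_monomial, hj]
  rw [← this, hp, Polynomial.coeff_zero]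

theorem cr_mul_powers (g : TestAlg d) (n : ℕ) {y : RSWN c d} (hy : y ∈ powers c d n) :
    cr c g * y ∈ powers c d (n + 1) := by
  induction hy using Submodule.span_induction with
  | mem y hy =>
    obtain ⟨f, rfl⟩ := hy
    have hc : Commute (cr c g) (cr c f) := cr_cr g f
    have h := coeff_mem (powers c d (n + 1)) (n + 1 + 1)
      (fun j => cr c g ^ j * cr c f ^ (n + 1 - j) * ((n + 1).choose j : RSWN c d)) (fun t => by
        have : cr c (t • g + f) ^ (n + 1) ∈ powers c d (n + 1) := Submodule.subset_span ⟨_, rfl⟩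
        rw [cr_add, cr_smul, (hc.smul_left t).add_pow] at this
        simpa only [smul_pow, smul_mul_assoc] using this) 1 (by omega)
    have h2 : ((n + 1 : ℕ) : RSWN c d) = algebraMap ℂ _ ((n + 1 : ℕ) : ℂ) := by simp
    simp only [pow_one, Nat.choose_one_right, Nat.add_sub_cancel] at h
    rw [h2, ← Algebra.commutes, ← Algebra.smul_def] at h
    exact (Submodule.smul_mem_iff _ (by exact_mod_cast Nat.succ_ne_zero n)).1 h
  | zero => simp
  | add y z _ _ hy hz => rw [mul_add]; exact add_mem hy hz
  | smul a y _ hy => rw [mul_smul_comm]; exact Submodule.smul_mem _ _ hy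

theorem words_le_powers (n : ℕ) : words c d n ≤ powers c d n := by
  refine Submodule.span_le.2 ?_
  rintro _ ⟨l, hl, rfl⟩
  induction l generalizing n with
  | nil => subst hl; exact Submodule.subset_span ⟨0, by simp⟩
  | cons f l ih =>
    subst hl
    exact cr_mul_powers f _ (ih _ rfl)

theorem star_word_mul (l : List (TestAlg d)) {n : ℕ} (hn : n < l.length) {y : RSWN c d}
    (hy : y ∈ words c d n ⊔ killed c d) : star (l.map (cr c)).prod * y ∈ killed c d := by
  induction l generalizing n y with
  | nil => simp at hn
  | cons f l ih =>
    rw [List.map_cons, List.prod_cons, star_mul, star_cr, mul_assoc]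
    cases n with
    | zero => exact mul_mem_killed _ (an_mul_sup_zero f hy)
    | succ n => exact ih (by simpa using hn) (an_mul_sup_succ f hy)

open Model

theorem vac_killed {y : RSWN c d} (hy : y ∈ killed c d) : vac c d y = 0 := by
  have : killed c d ≤ LinearMap.ker (vac c d) := by
    refine Submodule.span_le.2 ?_
    rintro _ (⟨x, g, rfl⟩ | ⟨x, g, rfl⟩)
    · exact vac_mul_an x g
    · exact vac_mul_nu x g
  exact this hy

theorem vac_orth_lt {m n : ℕ} (h : n < m) {x y : RSWN c d} (hx : x ∈ words c d m)
    (hy : y ∈ words c d n) : vac c d (star x * y) = 0 := by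
  induction hx using Submodule.span_induction with
  | mem x hx =>
    obtain ⟨l, rfl, rfl⟩ := hx
    exact vac_killed (star_word_mul l h (Submodule.mem_sup_left hy))
  | zero => simp
  | add x z _ _ hx hz => rw [star_add, add_mul, map_add, hx, hz, add_zero]
  | smul a x _ hx => rw [star_smul, smul_mul_assoc, map_smul, hx, smul_zero]

theorem vac_orth {m n : ℕ} (h : m ≠ n) {x y : RSWN c d} (hx : x ∈ words c d m)
    (hy : y ∈ words c d n) : vac c d (star x * y) = 0 := by
  rcases lt_or_gt_of_ne h with h | h
  · have := vac_orth_lt h hy hx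
    have h2 := vac_star (star y * x)
    rw [this, star_mul, star_star, map_zero] at h2
    exact h2
  · exact vac_orth_lt h hx hy

theorem vac_congr (z : RSWN c d) {x y : RSWN c d} (h : x - y ∈ killed c d) :
    vac c d (z * x) = vac c d (z * y) := by
  have := vac_killed (mul_mem_killed z h)
  rwa [mul_sub, map_sub, sub_eq_zero] at this

theorem nu_mul_pow (a g : TestAlg d) (m : ℕ) :
    nu c a * cr c g ^ (m + 1) - (2 * ((m : ℂ) + 1)) • (cr c (a * g) * cr c g ^ m) ∈
      killed c d := by
  have h := nu_cr (c := c) a g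
  rw [sub_eq_iff_eq_add] at h
  induction m with
  | zero =>
    convert mul_nu_mem (cr c g) a using 1
    simp [h]
  | succ m ih =>
    convert mul_mem_killed (cr c g) ih using 1
    rw [pow_succ' _ (m + 1), ← mul_assoc, h, mul_sub, mul_smul_comm, ← mul_assoc (cr c g) (cr c _),
      cr_cr g, mul_assoc (cr c _) (cr c g) (_ ^ _), ← pow_succ', add_mul, smul_mul_assoc, mul_assoc]
    push_cast
    module

theorem an_mul_pow (f g : TestAlg d) (n : ℕ) :
    an c f * cr c g ^ (n + 1) - ((2 * c * ((n : ℂ) + 1) * l2inner f g) • cr c g ^ n +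
      (4 * ((n : ℂ) + 1) * n) • (cr c (star f * g * g) * cr c g ^ (n - 1))) ∈ killed c d := by
  have h := an_cr (c := c) f g
  rw [sub_eq_iff_eq_add, ← mul_one (algebraMap _ _ _), ← Algebra.smul_def] at h
  induction n with
  | zero =>
    convert add_mem (mul_an_mem (cr c g) f) (Submodule.smul_mem _ (4 : ℂ)
      (mul_nu_mem (1 : RSWN c d) (star f * g))) using 1
    simp [h]
    abel
  | succ n ih =>
    convert add_mem (mul_mem_killed (cr c g) ih) (Submodule.smul_mem _ (4 : ℂ)
      (nu_mul_pow (c := c) (star f * g) g n)) using 1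
    have e : ((n : ℂ)) • (cr c g * (cr c (star f * g * g) * cr c g ^ (n - 1))) =
        (n : ℂ) • (cr c (star f * g * g) * cr c g ^ n) := by
      cases n with
      | zero => simp
      | succ n =>
        rw [← mul_assoc, cr_cr g, mul_assoc, ← pow_succ']; rfl
    have h1 : cr c g * ((2 * c * ((n : ℂ) + 1) * l2inner f g) • cr c g ^ n +
        (4 * ((n : ℂ) + 1) * n) • (cr c (star f * g * g) * cr c g ^ (n - 1))) =
        (2 * c * ((n : ℂ) + 1) * l2inner f g) • cr c g ^ (n + 1) +
        (4 * ((n : ℂ) + 1) * n) • (cr c (star f * g * g) * cr c g ^ n) := by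
      rw [mul_add, mul_smul_comm, mul_smul_comm, mul_smul (4 * ((n : ℂ) + 1)), e, ← mul_smul,
        ← pow_succ']
    have h2 : an c f * cr c g ^ (n + 1 + 1) = (2 * c * l2inner f g) • cr c g ^ (n + 1) +
        (4 : ℂ) • (nu c (star f * g) * cr c g ^ (n + 1)) +
        cr c g * (an c f * cr c g ^ (n + 1)) := by
      rw [pow_succ' _ (n + 1), ← mul_assoc, h, add_mul, add_mul, smul_mul_assoc, smul_mul_assoc,
        one_mul, mul_assoc (cr c g)]
    rw [mul_sub, h1, h2]
    push_cast
    module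

/-- The scalar products of `n`-particle vectors. -/
noncomputable def gramA (c : ℝ) (d n : ℕ) : Matrix (TestAlg d) (TestAlg d) ℂ :=
  fun f g => vac c d (an c f ^ n * cr c g ^ n)

/-- The function `conj f ^ k * g ^ (k + 1)`. -/
noncomputable def mixed (f g : TestAlg d) : ℕ → TestAlg d
  | 0 => g
  | k + 1 => star f * g * mixed f g k

/-- The function `f ^ (k + 1)`. -/
noncomputable def spow (f : TestAlg d) : ℕ → TestAlg d
  | 0 => f
  | k + 1 => f * spow f k

theorem star_mixed (f g : TestAlg d) (k : ℕ) :
    star (mixed g f k) * g * g = mixed f g (k + 1) := by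
  induction k with
  | zero => rfl
  | succ k ih =>
    have : star (mixed g f (k + 1)) * g * g = star f * g * (star (mixed g f k) * g * g) := by
      rw [mixed, star_mul, star_mul, star_star, mul_comm (star (mixed g f k)), mul_assoc, mul_assoc,
        mul_assoc (star (mixed g f k))]
    rw [this, ih, ← mixed]

theorem l2inner_mixed (f g : TestAlg d) (k : ℕ) :
    l2inner (mixed g f k) g = l2inner (spow f k) (spow g k) := by
  have key (k : ℕ) : ∀ a : TestAlg d,
      l2inner (mixed g f k * a) g = l2inner (spow f k * a) (spow g k) := by
    induction k with
    | zero => intro a; rfl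
    | succ k ih =>
      intro a
      have h1 : mixed g f (k + 1) * a = mixed g f k * (star g * (f * a)) := by
        rw [mixed]; ac_rfl
      have h2 : spow f k * (star g * (f * a)) = (f * spow f k * a) * star g := by ac_rfl
      rw [h1, ih, h2, l2inner_mul_left, star_star]; rfl
  cases k with
  | zero => rfl
  | succ k =>
    have h1 : mixed g f (k + 1) = mixed g f k * (star g * f) := by rw [mixed]; ac_rfl
    have h2 : spow f k * (star g * f) = (f * spow f k) * star g := by ac_rfl
    rw [h1, key, h2, l2inner_mul_left, star_star]; rfl

/-- Auxiliary matrices. -/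
noncomputable def gramQ (c : ℝ) (d k n : ℕ) : Matrix (TestAlg d) (TestAlg d) ℂ :=
  fun f g => vac c d (an c (mixed g f k) * an c f ^ n * cr c g ^ (n + 1))

/-- The matrix of scalar products of powers. -/
noncomputable def gramM (d k : ℕ) : Matrix (TestAlg d) (TestAlg d) ℂ :=
  fun f g => l2inner (spow f k) (spow g k)

theorem star_an_pow (f : TestAlg d) (n : ℕ) : star (an c f ^ n) = cr c f ^ n := by
  rw [star_pow, star_an]
theorem star_cr_pow (f : TestAlg d) (n : ℕ) : star (cr c f ^ n) = an c f ^ n := by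
  rw [star_pow, star_cr]

theorem gramA_succ (n : ℕ) : gramA c d (n + 1) = gramQ c d 0 n := by
  ext f g
  rw [gramA, gramQ, mixed, pow_succ']

theorem gramQ_eq (k n : ℕ) : gramQ c d k n =
    (2 * c * ((n : ℂ) + 1)) • (gramM d k).hadamard (gramA c d n) +
      (4 * ((n : ℂ) + 1) * n) • (gramQ c d (k + 1) (n - 1)).conjTranspose := by
  ext f g
  have hc : Commute (an c (mixed g f k)) (an c f ^ n) :=
    Commute.pow_right (an_an _ _) n
  simp only [gramQ, Matrix.add_apply, Matrix.smul_apply, Matrix.hadamard_apply,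
    Matrix.conjTranspose_apply]
  rw [hc.eq, mul_assoc, vac_congr _ (an_mul_pow (c := c) (mixed g f k) g n), mul_add, map_add,
    mul_smul_comm, mul_smul_comm, map_smul, map_smul, l2inner_mixed, star_mixed]
  congr 1
  · simp only [smul_eq_mul, gramM, gramA]; ring
  · cases n with
    | zero => simp
    | succ n =>
      congr 1
      rw [Complex.star_def, ← vac_star]
      simp only [star_mul, star_an, star_an_pow, star_cr_pow, Nat.add_sub_cancel]
      rw [← (Commute.pow_right (cr_cr _ _) n : Commute (cr c (mixed f g (k + 1))) (cr c g ^ n)).eq]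

theorem gramM_psd (k : ℕ) : (gramM d k).PosSemidef := by
  refine ⟨?_, fun x => ?_⟩
  · ext f g
    simp only [Matrix.conjTranspose_apply, gramM, Complex.star_def, l2inner_conj]
  · have : (x.sum fun i xi => x.sum fun j xj => star xi * gramM d k i j * xj) =
        l2inner (x.sum fun i xi => xi • spow i k) (x.sum fun i xi => xi • spow i k) := by
      have hr (u : TestAlg d) : l2inner u (x.sum fun i xi => xi • spow i k) =
          x.sum fun i xi => xi * l2inner u (spow i k) := by
        have := map_finsuppSum (pairL u) x fun i xi => xi • spow i k
        simpa only [pairL_apply, map_smul, smul_eq_mul] using this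
      have hl (u : TestAlg d) : l2inner (x.sum fun i xi => xi • spow i k) u =
          x.sum fun i xi => conj xi * l2inner (spow i k) u := by
        rw [← l2inner_conj, hr]
        simp only [Finsupp.sum, map_sum, map_mul, l2inner_conj]
      rw [hl]
      refine Finset.sum_congr rfl fun i _ => ?_
      dsimp only
      rw [hr]
      simp only [Finsupp.sum, Finset.mul_sum, gramM, Complex.star_def]
      exact Finset.sum_congr rfl fun j _ => by ring
    rw [this]
    exact l2inner_self_nonneg _

theorem gramA_zero_psd : (gramA c d 0).PosSemidef := by
  refine ⟨?_, fun x => ?_⟩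
  · ext f g
    simp [gramA, vac_one]
  · have : (x.sum fun i xi => x.sum fun j xj => star xi * gramA c d 0 i j * xj) =
        star (x.sum fun i xi => xi) * (x.sum fun i xi => xi) := by
      simp [gramA, vac_one, Finsupp.sum, Finset.sum_mul_sum]
    rw [this]
    exact star_mul_self_nonneg _

theorem gram_psd (hc : 0 < c) (n : ℕ) :
    (gramA c d n).PosSemidef ∧ ∀ k, (gramQ c d k n).PosSemidef := by
  induction n with
  | zero =>
    refine ⟨gramA_zero_psd, fun k => ?_⟩
    rw [gramQ_eq]
    simp only [Nat.cast_zero, mul_zero, zero_smul, add_zero]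
    refine Matrix.PosSemidef.smul ((gramM_psd k).hadamard gramA_zero_psd) ?_
    have : (0 : ℂ) ≤ c := by exact_mod_cast hc.le
    positivity
  | succ n ih =>
    have hA : (gramA c d (n + 1)).PosSemidef := by rw [gramA_succ]; exact ih.2 0
    refine ⟨hA, fun k => ?_⟩
    rw [gramQ_eq]
    have : (0 : ℂ) ≤ c := by exact_mod_cast hc.le
    refine Matrix.PosSemidef.add (Matrix.PosSemidef.smul ((gramM_psd k).hadamard hA) ?_)
      (Matrix.PosSemidef.smul (ih.2 (k + 1)).conjTranspose ?_) <;> positivity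

theorem vac_words_nonneg (hc : 0 < c) {n : ℕ} {x : RSWN c d} (hx : x ∈ words c d n) :
    0 ≤ vac c d (star x * x) := by
  obtain ⟨a, rfl⟩ := (Finsupp.mem_span_range_iff_exists_finsupp).1 (words_le_powers n hx)
  have := (gram_psd (d := d) hc n).1.2 a
  convert this using 1
  simp only [Finsupp.sum, star_sum, Finset.sum_mul_sum, map_sum, star_smul, smul_mul_smul_comm,
    map_smul, star_cr_pow, gramA, smul_eq_mul]
  refine Finset.sum_congr rfl fun i _ => Finset.sum_congr rfl fun j _ => ?_
  ring

theorem vac_nonneg (hc : 0 < c) (x : RSWN c d) : 0 ≤ vac c d (star x * x) := by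
  obtain ⟨u, hu, v, hv, rfl⟩ := Submodule.mem_sup.1 (mem_sup_words x)
  have h1 : vac c d (star u * v) = 0 := vac_killed (mul_mem_killed _ hv)
  have h2 : vac c d (star v * v) = 0 := vac_killed (mul_mem_killed _ hv)
  have h3 : vac c d (star v * u) = 0 := by
    have := vac_star (star u * v)
    rwa [h1, map_zero, star_mul, star_star] at this
  rw [star_add, add_mul, mul_add, mul_add, map_add, map_add, map_add, h1, h2, h3, add_zero,
    add_zero, add_zero]
  obtain ⟨a, ha, rfl⟩ := (Submodule.mem_iSup_iff_exists_finsupp _ _).1 hu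
  rw [Finsupp.sum, star_sum, Finset.sum_mul_sum, map_sum]
  refine Finset.sum_nonneg fun i hi => ?_
  rw [map_sum, Finset.sum_eq_single i]
  · exact vac_words_nonneg hc (ha i)
  · intro j _ hj
    exact vac_orth (Ne.symm hj) (ha i) (ha j)
  · intro h; exact absurd hi h

/-- There is exactly one Fock state. -/
theorem existsUnique_isFockState (hc : 0 < c) (d : ℕ) :
    ∃! φ : RSWN c d →ₗ[ℂ] ℂ, IsFockState φ :=
  ⟨vac c d, ⟨vac_one, vac_nonneg hc, vac_mul_an, vac_mul_nu⟩, fun _ h =>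
    h.unique ⟨vac_one, vac_nonneg hc, vac_mul_an, vac_mul_nu⟩⟩

/-! ### The quadratic Fock space -/

/-- The quadratic Fock state, i.e. the unique state `φ` with `φ(x B_g) = φ(x N_g) = 0`. -/
noncomputable def fockState (hc : 0 < c) (d : ℕ) : RSWN c d →ₗ[ℂ] ℂ :=
  (existsUnique_isFockState hc d).choose

theorem isFockState_fockState (hc : 0 < c) (d : ℕ) : IsFockState (fockState hc d) :=
  (existsUnique_isFockState hc d).choose_spec.1

/-- The algebra, as a space with the (semidefinite) scalar product of the Fock state. -/
def PreFock (_hc : 0 < c) (d : ℕ) : Type := RSWN c d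

variable {hc : 0 < c}

noncomputable instance : AddCommGroup (PreFock hc d) := inferInstanceAs (AddCommGroup (RSWN c d))
noncomputable instance : Module ℂ (PreFock hc d) := inferInstanceAs (Module ℂ (RSWN c d))

/-- The identity map. -/
noncomputable def toPreFock (hc : 0 < c) (d : ℕ) : RSWN c d ≃ₗ[ℂ] PreFock hc d :=
  LinearEquiv.refl ℂ _

/-- The scalar product `⟨x, y⟩ = φ(x* y)`. -/
noncomputable abbrev preFockCore (hc : 0 < c) (d : ℕ) :
    PreInnerProductSpace.Core ℂ (PreFock hc d) where
  inner x y := fockState hc d (star ((toPreFock hc d).symm x) * (toPreFock hc d).symm y)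
  conj_inner_symm x y := by
    rw [← (isFockState_fockState hc d).star, star_mul, star_star]
  re_inner_nonneg x := (Complex.nonneg_iff.1 ((isFockState_fockState hc d).nonneg _)).1
  add_left x y z := by rw [map_add, star_add, add_mul, map_add]
  smul_left x y z := by
    rw [map_smul, star_smul, smul_mul_assoc, map_smul]; rfl

noncomputable instance : SeminormedAddCommGroup (PreFock hc d) :=
  InnerProductSpace.Core.toSeminormedAddCommGroup (c := preFockCore hc d)
noncomputable instance : InnerProductSpace ℂ (PreFock hc d) :=
  InnerProductSpace.ofCore (preFockCore hc d)

/-- The quadratic Fock space `Γ₂(L²(ℝᵈ) ∩ L^∞(ℝᵈ))`: the GNS Hilbert space of the Fock state. -/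
abbrev Fock (hc : 0 < c) (d : ℕ) : Type := UniformSpace.Completion (PreFock hc d)

/-- The vector `xΦ` of the GNS space. -/
noncomputable def toFock (hc : 0 < c) (d : ℕ) (x : RSWN c d) : Fock hc d :=
  ((toPreFock hc d x : PreFock hc d) : Fock hc d)

theorem inner_toFock (x y : RSWN c d) :
    inner ℂ (toFock hc d x) (toFock hc d y) = fockState hc d (star x * y) :=
  UniformSpace.Completion.inner_coe _ _

/-- The vacuum vector `Φ`. -/
noncomputable def vacuum (hc : 0 < c) (d : ℕ) : Fock hc d := toFock hc d 1

/-- The `n`-particle vector `(B⁺_f)ⁿ Φ`. -/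
noncomputable def particleVec (hc : 0 < c) (n : ℕ) (f : TestAlg d) : Fock hc d :=
  toFock hc d (cr c f ^ n)

/-- The quadratic `n`-particle space. -/
noncomputable def particleSpace (hc : 0 < c) (d n : ℕ) : Submodule ℂ (Fock hc d) :=
  (Submodule.span ℂ (Set.range fun f : TestAlg d => particleVec hc n f)).topologicalClosure

/-- The quadratic exponential vector `Ψ(f) = ∑ (B⁺_f)ⁿ Φ / n!` exists and is equal to `v`. -/
def IsExpVec (hc : 0 < c) (f : TestAlg d) (v : Fock hc d) : Prop :=
  HasSum (fun n : ℕ => ((n.factorial : ℂ)⁻¹) • particleVec hc n f) v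

/-- The linear span of all quadratic exponential vectors. -/
noncomputable def expSpan (hc : 0 < c) (d : ℕ) : Submodule ℂ (Fock hc d) :=
  Submodule.span ℂ {v | ∃ f : TestAlg d, IsExpVec hc f v}

/-- `G` is the quadratic second quantization `Γ₂(T)`: the linear operator whose domain is the span
of the exponential vectors and with `Γ₂(T) Ψ(f) = Ψ(T f)` for all exponential vectors `Ψ(f)`
(in particular `Ψ(T f)` exists whenever `Ψ(f)` does). These requirements determine `G`. -/
def IsSecondQuantization (hc : 0 < c) (T : TestAlg d →ₗ[ℂ] TestAlg d)
    (G : Fock hc d →ₗ.[ℂ] Fock hc d) : Prop :=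
  G.domain = expSpan hc d ∧
    ∀ (f : TestAlg d) (v : Fock hc d), IsExpVec hc f v →
      ∃ w : Fock hc d, IsExpVec hc (T f) w ∧ (v, w) ∈ G.graph

end QuadFock

open QuadFock

/-!
The vectors `(B⁺_f)ⁿ Φ` are total in the Fock space by normal ordering, and orthogonal for
different `n`, so that the Fock space is the Hilbert sum of the particle spaces. Everything is
done component by component in this decomposition.

*Second quantization.* A bounded operator that maps `(B⁺_f)ⁿ Φ` to `(B⁺_{Tf})ⁿ Φ` maps the
exponential series of `f` to that of `T f`, hence restricts to `Γ₂(T)` on the span of the exponential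
vectors (`isSecondQuantization_toPMap`). This span is dense: the recursion for the Gram matrices
gives `‖(B⁺_f)ⁿ Φ‖ ≤ n! Rⁿ`, so `t ↦ Ψ(t f)` is analytic near `0`, and its Taylor coefficients lie
in the closed span of its values (`topologicalClosure_expSpan`).

*Contractivity.* The Gram matrix `Aₙ(f, g)` of the `n`-particle vectors is obtained from the
matrices `M_k(f, g) = ⟨f^{k+1}, g^{k+1}⟩` by sums with positive coefficients and entrywise
products. Entrywise products respect the order of positive semidefinite matrices, so
`Aₙ(Tf, Tg) ≤ Aₙ(f, g)` follows from `M_k(Tf, Tg) ≤ M_k(f, g)` (`posSemidef_gram_sub`). For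
`T = M_φ T₁` the latter holds since `(T f)^{k+1} = φᵏ T(f^{k+1})` depends linearly and
contractively on `f^{k+1}` (`posSemidef_gramM_sub`).

*The semigroup.* `S(z)` multiplies the `n`-th component by `e^{zn}`, and `H₀` multiplies it by `n`
on its maximal domain (`numOp`). On `Re z < 0` the operator `S(z)` is the norm convergent sum of
`e^{zn}` times projections. Continuity up to the boundary and the existence of the
derivative at `0` are dominated convergence (`tendsto_zero_of_coord`), with `|e^u - 1| ≤ |u|` for
`Re u ≤ 0`; conversely a derivative is read off from the components
(`IsExpDiagonal.mem_graph_iff`).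
-/

namespace QuadFock

/-! ### Diagonal operators on a Hilbert sum -/

section Diagonal

open Filter Topology

variable {H : Type*} [NormedAddCommGroup H] [InnerProductSpace ℂ H]
  {G : ℕ → Type*} [∀ n, NormedAddCommGroup (G n)] [∀ n, InnerProductSpace ℂ (G n)]

/-- The `n`-th component of a vector, with respect to an identification of `H` with a Hilbert
sum. -/
noncomputable def coord (U : H ≃ₗᵢ[ℂ] lp G 2) (n : ℕ) : H →L[ℂ] G n :=
  lp.evalCLM ℂ G 2 n ∘L (U.toContinuousLinearEquiv : H →L[ℂ] lp G 2)

theorem coord_apply (U : H ≃ₗᵢ[ℂ] lp G 2) (n : ℕ) (v : H) : coord U n v = U v n := rfl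

variable {U : H ≃ₗᵢ[ℂ] lp G 2}

theorem coord_ext {v w : H} (h : ∀ n, coord U n v = coord U n w) : v = w :=
  U.injective (lp.ext (funext h))

theorem hasSum_norm_coord (v : H) : HasSum (fun n => ‖coord U n v‖ ^ 2) (‖v‖ ^ 2) := by
  have h := lp.hasSum_norm (p := 2) (by norm_num) (U v)
  rw [U.norm_map] at h
  exact_mod_cast h

theorem hasSum_inner_coord (v w : H) :
    HasSum (fun n => inner ℂ (coord U n v) (coord U n w)) (inner ℂ v w) := by
  rw [← U.inner_map_map v w]
  exact lp.hasSum_inner (U v) (U w)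

theorem norm_le_of_coord {v w : H} {C : ℝ} (hC : 0 ≤ C)
    (h : ∀ n, ‖coord U n v‖ ≤ C * ‖coord U n w‖) : ‖v‖ ≤ C * ‖w‖ := by
  refine le_of_sq_le_sq ?_ (by positivity)
  rw [mul_pow]
  refine hasSum_le (fun n => ?_) (hasSum_norm_coord (U := U) v)
    ((hasSum_norm_coord (U := U) w).mul_left (C ^ 2))
  rw [← mul_pow]
  exact pow_le_pow_left₀ (norm_nonneg _) (h n) 2

/-- A bounded sequence of scalars defines a diagonal operator. -/
theorem exists_diagonal (U : H ≃ₗᵢ[ℂ] lp G 2) (m : ℕ → ℂ) {C : ℝ} (hC : 0 ≤ C)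
    (hm : ∀ n, ‖m n‖ ≤ C) :
    ∃ D : H →L[ℂ] H, ‖D‖ ≤ C ∧ ∀ v n, coord U n (D v) = m n • coord U n v := by
  have hmem (v : H) : Memℓp (fun n => m n • U v n) 2 := by
    refine memℓp_gen ?_
    have hs : Summable fun n => C ^ 2 * ‖coord U n v‖ ^ 2 :=
      (hasSum_norm_coord (U := U) v).summable.mul_left (C ^ 2)
    refine .of_nonneg_of_le (fun n => by positivity) (fun n => ?_) hs
    have h2 : (2 : ℝ≥0∞).toReal = (2 : ℕ) := by norm_num
    rw [h2, Real.rpow_natCast, norm_smul, mul_pow, coord_apply]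
    gcongr
    exact hm n
  let D₀ : H →ₗ[ℂ] H :=
    { toFun v := U.symm ⟨fun n => m n • U v n, hmem v⟩
      map_add' v w := by
        refine coord_ext (U := U) fun n => ?_
        simp only [coord_apply, LinearIsometryEquiv.apply_symm_apply, map_add, lp.coeFn_add,
          Pi.add_apply, smul_add]
      map_smul' z v := by
        refine coord_ext (U := U) fun n => ?_
        simp only [coord_apply, LinearIsometryEquiv.apply_symm_apply, map_smul, lp.coeFn_smul,
          Pi.smul_apply, RingHom.id_apply]
        exact smul_comm _ _ _ }
  have hD (v : H) (n : ℕ) : coord U n (D₀ v) = m n • coord U n v := by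
    simp only [D₀, coord_apply, LinearMap.coe_mk, AddHom.coe_mk,
      LinearIsometryEquiv.apply_symm_apply]
  refine ⟨D₀.mkContinuous C fun v => norm_le_of_coord (U := U) hC fun n => ?_,
    LinearMap.mkContinuous_norm_le _ hC _, hD⟩
  rw [hD, norm_smul]
  exact mul_le_mul_of_nonneg_right (hm n) (norm_nonneg _)

/-- Dominated convergence in a Hilbert sum. -/
theorem tendsto_zero_of_coord {α : Type*} {l : Filter α} {x : α → H} {w : H} {C : ℝ}
    (hb : ∀ᶠ a in l, ∀ n, ‖coord U n (x a)‖ ≤ C * ‖coord U n w‖)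
    (hlim : ∀ n, Tendsto (fun a => coord U n (x a)) l (𝓝 0)) : Tendsto x l (𝓝 0) := by
  have key : Tendsto (fun a => ∑' n, ‖coord U n (x a)‖ ^ 2) l (𝓝 (∑' _ : ℕ, (0 : ℝ))) := by
    refine tendsto_tsum_of_dominated_convergence
      (bound := fun n => C ^ 2 * ‖coord U n w‖ ^ 2)
      ((hasSum_norm_coord (U := U) w).summable.mul_left _) (fun n => ?_) ?_
    · simpa using ((hlim n).norm).pow 2
    · filter_upwards [hb] with a ha n
      rw [Real.norm_of_nonneg (by positivity), ← mul_pow]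
      exact pow_le_pow_left₀ (norm_nonneg _) (ha n) 2
  simp only [(hasSum_norm_coord (U := U) _).tsum_eq, tsum_zero] at key
  rw [tendsto_zero_iff_norm_tendsto_zero]
  simpa [Real.sqrt_sq] using key.sqrt

theorem exists_coord_eq_single (U : H ≃ₗᵢ[ℂ] lp G 2) (n : ℕ) (a : G n) :
    ∃ v : H, coord U n v = a ∧ ∀ k ≠ n, coord U k v = 0 := by
  refine ⟨U.symm (lp.single 2 n a), ?_, fun k hk => ?_⟩
  · rw [coord_apply, LinearIsometryEquiv.apply_symm_apply, lp.single_apply_self]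
  · rw [coord_apply, LinearIsometryEquiv.apply_symm_apply, lp.single_apply_ne _ _ _ hk]

/-! ### The semigroup with spectrum in `ℕ` -/

/-- `S` acts on the `n`-th summand as multiplication by `e^{zn}`, for `Re z ≤ 0`. -/
def IsExpDiagonal (U : H ≃ₗᵢ[ℂ] lp G 2) (S : ℂ → H →L[ℂ] H) : Prop :=
  ∀ z : ℂ, z.re ≤ 0 → ∀ v n, coord U n (S z v) = Complex.exp (z * n) • coord U n v

theorem norm_exp_mul_natCast_le {z : ℂ} (hz : z.re ≤ 0) (n : ℕ) :
    ‖Complex.exp (z * n)‖ ≤ 1 := by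
  rw [Complex.norm_exp, Real.exp_le_one_iff]
  simpa using mul_nonpos_of_nonpos_of_nonneg hz n.cast_nonneg

theorem exists_isExpDiagonal (U : H ≃ₗᵢ[ℂ] lp G 2) :
    ∃ S : ℂ → H →L[ℂ] H, IsExpDiagonal U S ∧ ∀ z : ℂ, z.re ≤ 0 → ‖S z‖ ≤ 1 := by
  have (z : ℂ) : ∃ D : H →L[ℂ] H, z.re ≤ 0 →
      ‖D‖ ≤ 1 ∧ ∀ v n, coord U n (D v) = Complex.exp (z * n) • coord U n v := by
    by_cases hz : z.re ≤ 0
    · obtain ⟨D, hD⟩ := exists_diagonal U _ zero_le_one (norm_exp_mul_natCast_le hz)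
      exact ⟨D, fun _ => hD⟩
    · exact ⟨0, fun h => absurd h hz⟩
  choose S hS using this
  exact ⟨S, fun z hz => (hS z hz).2, fun z hz => (hS z hz).1⟩

variable {S : ℂ → H →L[ℂ] H}

theorem IsExpDiagonal.zero (hS : IsExpDiagonal U S) : S 0 = 1 := by
  ext v
  refine coord_ext (U := U) fun n => ?_
  rw [hS 0 le_rfl]
  simp

theorem IsExpDiagonal.add (hS : IsExpDiagonal U S) {z w : ℂ} (hz : z.re ≤ 0) (hw : w.re ≤ 0) :
    S (z + w) = S z ∘L S w := by
  ext v
  refine coord_ext (U := U) fun n => ?_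
  rw [ContinuousLinearMap.comp_apply, hS z hz, hS w hw,
    hS (z + w) (by rw [Complex.add_re]; linarith), smul_smul, ← Complex.exp_add, add_mul]

theorem IsExpDiagonal.apply_of_coord (hS : IsExpDiagonal U S) {z : ℂ} (hz : z.re ≤ 0) {n : ℕ}
    {v : H} (hv : ∀ k ≠ n, coord U k v = 0) : S z v = Complex.exp (z * n) • v := by
  refine coord_ext (U := U) fun k => ?_
  rw [hS z hz, map_smul]
  by_cases hk : k = n
  · rw [hk]
  · rw [hv k hk, smul_zero, smul_zero]

/-- The operators `S z` are the norm convergent sums of `e^{zn} Pₙ` with orthogonal projections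
`Pₙ`. -/
theorem IsExpDiagonal.differentiableOn [CompleteSpace H] (hS : IsExpDiagonal U S) :
    DifferentiableOn ℂ S {z | z.re < 0} := by
  have hproj (n : ℕ) : ∃ D : H →L[ℂ] H, ‖D‖ ≤ 1 ∧
      ∀ v k, coord U k (D v) = (if k = n then (1 : ℂ) else 0) • coord U k v :=
    exists_diagonal U _ zero_le_one fun k => by split_ifs <;> simp
  choose P hP1 hP using hproj
  have hbound {r : ℝ} {z : ℂ} (hz : z.re < r) (n : ℕ) :
      ‖Complex.exp (z * n) • P n‖ ≤ Real.exp r ^ n := by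
    rw [norm_smul, Complex.norm_exp, ← Real.exp_nat_mul]
    calc _ ≤ Real.exp (n * r) * 1 := by
          gcongr
          · simp only [Complex.mul_re, Complex.natCast_re, Complex.natCast_im, mul_zero, sub_zero]
            nlinarith [n.cast_nonneg (α := ℝ)]
          · exact hP1 n
      _ = _ := mul_one _
  have hgeom {r : ℝ} (hr : r < 0) : Summable fun n : ℕ => Real.exp r ^ n :=
    summable_geometric_of_lt_one (Real.exp_nonneg _) (by simpa using hr)
  have hsum {z : ℂ} (hz : z.re < 0) : S z = ∑' n : ℕ, Complex.exp (z * n) • P n := by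
    have hs : Summable fun n : ℕ => Complex.exp (z * n) • P n :=
      .of_norm_bounded (hgeom (r := z.re / 2) (by linarith)) (hbound (by linarith))
    ext v
    refine coord_ext (U := U) fun k => ?_
    have h := ((hs.hasSum.mapL (ContinuousLinearMap.apply ℂ H v)).mapL (coord U k)).tsum_eq
    simp only [ContinuousLinearMap.apply_apply] at h
    rw [← h, hS z hz.le, tsum_eq_single k]
    · simp [hP]
    · intro n hn
      simp [hP, hn.symm]
  intro z hz
  rw [Set.mem_ofPred_eq] at hz
  have hopen : IsOpen {w : ℂ | w.re < z.re / 2} := isOpen_lt Complex.continuous_re continuous_const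
  have hmem : z ∈ {w : ℂ | w.re < z.re / 2} := by
    rw [Set.mem_ofPred_eq]; linarith
  have hd : DifferentiableOn ℂ (fun w : ℂ => ∑' n : ℕ, Complex.exp (w * n) • P n)
      {w : ℂ | w.re < z.re / 2} :=
    Complex.differentiableOn_tsum_of_summable_norm (hgeom (r := z.re / 2) (by linarith))
      (fun n => by fun_prop) hopen fun n w hw => hbound hw n
  refine ((hd.differentiableAt (hopen.mem_nhds hmem)).congr_of_eventuallyEq ?_).differentiableWithinAt
  filter_upwards [hopen.mem_nhds hmem] with w hw
  exact hsum (by linarith)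

theorem IsExpDiagonal.continuousOn (hS : IsExpDiagonal U S) (v : H) :
    ContinuousOn (fun z => S z v) {z | z.re ≤ 0} := by
  intro z hz
  rw [ContinuousWithinAt, ← tendsto_sub_nhds_zero_iff]
  refine tendsto_zero_of_coord (U := U) (w := v) (C := 2) ?_ fun n => ?_
  · filter_upwards [self_mem_nhdsWithin] with w hw n
    rw [map_sub, hS w hw, hS z hz, ← sub_smul, norm_smul]
    gcongr
    refine (norm_sub_le _ _).trans ?_
    linarith [norm_exp_mul_natCast_le hw n, norm_exp_mul_natCast_le hz n]
  · have hc : ContinuousWithinAt (fun w : ℂ => Complex.exp (w * n) • coord U n v)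
        {z | z.re ≤ 0} z := by fun_prop
    refine (tendsto_sub_nhds_zero_iff.2 hc).congr' ?_
    filter_upwards [self_mem_nhdsWithin] with w hw
    rw [map_sub, hS w hw, hS z hz]

theorem IsExpDiagonal.mem_unitary [CompleteSpace H] (hS : IsExpDiagonal U S) (t : ℝ) :
    S (t * Complex.I) ∈ unitary (H →L[ℂ] H) := by
  have hre (t : ℝ) : (t * Complex.I : ℂ).re ≤ 0 := by simp
  have hinv (t : ℝ) : S (t * Complex.I) ∘L S ((-t : ℝ) * Complex.I) = 1 := by
    rw [← hS.add (hre t) (hre _), ← hS.zero]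
    congr 1
    push_cast
    ring
  have hstar : star (S (t * Complex.I)) * S (t * Complex.I) = 1 := by
    refine (ContinuousLinearMap.inner_map_map_iff_adjoint_comp_self _).1 fun v w => ?_
    refine (hasSum_inner_coord (U := U) _ _).unique ?_
    refine (hasSum_inner_coord (U := U) v w).congr_fun fun n => ?_
    rw [hS _ (hre t), hS _ (hre t), inner_smul_left, inner_smul_right, ← mul_assoc,
      Complex.conj_mul', Complex.norm_exp]
    simp
  rw [Unitary.mem_iff]
  refine ⟨hstar, ?_⟩
  have h1 : S (t * Complex.I) * S ((-t : ℝ) * Complex.I) = 1 := hinv t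
  rwa [left_inv_eq_right_inv hstar h1]

/-! ### The number operator -/

/-- The pairs `(v, w)` such that the components of `w` are `n` times those of `v`. -/
def numGraph (U : H ≃ₗᵢ[ℂ] lp G 2) : Submodule ℂ (H × H) where
  carrier := {x | ∀ n, coord U n x.2 = (n : ℂ) • coord U n x.1}
  add_mem' hx hy n := by simp [hx n, hy n]
  zero_mem' n := by simp
  smul_mem' z x hx n := by simp [hx n, smul_comm z]

/-- The self-adjoint operator that acts on the `n`-th summand as multiplication by `n`, with its
maximal domain. -/
noncomputable def numOp (U : H ≃ₗᵢ[ℂ] lp G 2) : H →ₗ.[ℂ] H := (numGraph U).toLinearPMap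

theorem mem_graph_numOp {v w : H} :
    (v, w) ∈ (numOp U).graph ↔ ∀ n, coord U n w = (n : ℂ) • coord U n v := by
  rw [numOp, Submodule.toLinearPMap_graph_eq]
  · rfl
  · rintro ⟨v, w⟩ h rfl
    refine coord_ext (U := U) fun n => ?_
    simpa using h n

theorem coord_numOp (x : (numOp U).domain) (n : ℕ) :
    coord U n (numOp U x) = (n : ℂ) • coord U n (x : H) :=
  mem_graph_numOp.1 ((numOp U).mem_graph x) n

theorem inner_numOp_nonneg (x : (numOp U).domain) : 0 ≤ inner ℂ (x : H) (numOp U x) := by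
  refine (hasSum_inner_coord (U := U) _ _).nonneg fun n => ?_
  rw [coord_numOp, inner_smul_right, inner_self_eq_norm_sq_to_K]
  have : (0 : ℂ) ≤ ((n * ‖coord U n (x : H)‖ ^ 2 : ℝ) : ℂ) := by
    exact_mod_cast (by positivity)
  simpa using this

theorem exists_single_mem_graph_numOp (n : ℕ) (a : G n) :
    ∃ v : H, coord U n v = a ∧ (∀ k ≠ n, coord U k v = 0) ∧ (v, (n : ℂ) • v) ∈ (numOp U).graph := by
  obtain ⟨v, hv, h0⟩ := exists_coord_eq_single U n a
  refine ⟨v, hv, h0, mem_graph_numOp.2 fun k => ?_⟩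
  by_cases hk : k = n
  · rw [hk, map_smul]
  · rw [map_smul, h0 k hk, smul_zero, smul_zero]

theorem inner_eq_inner_coord {v : H} {n : ℕ} (h : ∀ k ≠ n, coord U k v = 0) (w : H) :
    inner ℂ w v = inner ℂ (coord U n w) (coord U n v) :=
  (hasSum_inner_coord (U := U) w v).unique
    (hasSum_single n fun k hk => by rw [h k hk, inner_zero_right])

theorem dense_domain_numOp [CompleteSpace H] (U : H ≃ₗᵢ[ℂ] lp G 2) :
    Dense ((numOp U).domain : Set H) := by
  rw [Submodule.dense_iff_topologicalClosure_eq_top, Submodule.topologicalClosure_eq_top_iff,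
    Submodule.eq_bot_iff]
  intro w hw
  refine coord_ext (U := U) fun n => ?_
  obtain ⟨v, hv, h0, hg⟩ := exists_single_mem_graph_numOp (U := U) n (coord U n w)
  have h := (Submodule.mem_orthogonal' _ _).1 hw v (LinearPMap.mem_domain_of_mem_graph hg)
  rw [inner_eq_inner_coord h0, hv, inner_self_eq_zero] at h
  rw [h, map_zero]

theorem isSelfAdjoint_numOp [CompleteSpace H] (U : H ≃ₗᵢ[ℂ] lp G 2) :
    IsSelfAdjoint (numOp U) := by
  have hd := dense_domain_numOp U
  have hsym : (numOp U).IsFormalAdjoint (numOp U) := fun x y => by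
    refine (hasSum_inner_coord (U := U) _ _).unique ?_
    refine (hasSum_inner_coord (U := U) _ _).congr_fun fun n => ?_
    rw [coord_numOp, coord_numOp, inner_smul_left, inner_smul_right, Complex.conj_natCast]
  rw [LinearPMap.isSelfAdjoint_def]
  refine le_antisymm (LinearPMap.le_of_le_graph ?_) (hsym.le_adjoint hd)
  rintro ⟨y, u⟩ hyu
  obtain ⟨y', rfl, rfl⟩ := (LinearPMap.mem_graph_iff _).1 hyu
  -- Test vectors from the `n`-th summand give the `n`-th component of the adjoint.
  refine mem_graph_numOp.2 fun n => ext_inner_right ℂ fun a => ?_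
  obtain ⟨v, rfl, h0, hg⟩ := exists_single_mem_graph_numOp (U := U) n a
  obtain ⟨x, rfl, hx⟩ := (LinearPMap.mem_graph_iff _).1 hg
  have h := LinearPMap.adjoint_isFormalAdjoint hd y' x
  rw [hx, inner_smul_right, inner_eq_inner_coord h0, inner_eq_inner_coord h0] at h
  rw [h, inner_smul_left, Complex.conj_natCast]

theorem mem_graph_numOp_natCast_smul {n : ℕ} {v : H} :
    (v, (n : ℂ) • v) ∈ (numOp U).graph ↔ ∀ k ≠ n, coord U k v = 0 := by
  rw [mem_graph_numOp]
  refine forall_congr' fun k => ?_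
  rw [map_smul, ← sub_eq_zero, ← sub_smul, smul_eq_zero, sub_eq_zero, Nat.cast_inj, eq_comm,
    or_iff_not_imp_left]

/-- On the left half-plane, where the derivative of the exponential is bounded by one. -/
theorem norm_exp_sub_one_le_norm {u : ℂ} (hu : u.re ≤ 0) : ‖Complex.exp u - 1‖ ≤ ‖u‖ := by
  have h := (convex_halfSpace_re_le 0).norm_image_sub_le_of_norm_hasDerivWithin_le
    (f := Complex.exp) (f' := Complex.exp) (C := 1) (x := 0) (y := u)
    (fun x _ => (Complex.hasDerivAt_exp x).hasDerivWithinAt)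
    (fun x hx => by rw [Complex.norm_exp, Real.exp_le_one_iff]; exact hx) (by simp) hu
  simpa using h

theorem IsExpDiagonal.hasDerivWithinAt (hS : IsExpDiagonal U S) {v w : H}
    (h : ∀ n, coord U n w = (n : ℂ) • coord U n v) :
    HasDerivWithinAt (fun z => S z v) w {z | z.re ≤ 0} 0 := by
  rw [hasDerivWithinAt_iff_tendsto_slope, ← tendsto_sub_nhds_zero_iff]
  have hcoord {z : ℂ} (hz : z ∈ {z : ℂ | z.re ≤ 0}) (n : ℕ) :
      coord U n (slope (fun z => S z v) 0 z - w) =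
        (slope (fun z : ℂ => Complex.exp (z * n)) 0 z - n) • coord U n v := by
    rw [map_sub, slope_def_module, map_smul, map_sub, hS z hz, hS 0 le_rfl, h, slope_def_module,
      sub_smul, smul_assoc, sub_smul]
  refine tendsto_zero_of_coord (U := U) (w := w) (C := 2) ?_ fun n => ?_
  · filter_upwards [self_mem_nhdsWithin] with z hz n
    rw [hcoord hz.1, h, norm_smul, norm_smul, ← mul_assoc]
    gcongr
    refine (norm_sub_le _ _).trans ?_
    have hz0 : 0 < ‖z‖ := norm_pos_iff.2 hz.2
    have hre : (z * n).re ≤ 0 := by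
      simpa using mul_nonpos_of_nonpos_of_nonneg hz.1 n.cast_nonneg
    have hle := norm_exp_sub_one_le_norm hre
    rw [norm_mul] at hle
    have hslope : ‖slope (fun z : ℂ => Complex.exp (z * n)) 0 z‖ ≤ ‖(n : ℂ)‖ := by
      rw [slope_def_module, norm_smul, norm_inv, sub_zero, zero_mul, Complex.exp_zero,
        inv_mul_le_iff₀ hz0]
      exact hle
    linarith
  · have hd : HasDerivWithinAt (fun z : ℂ => Complex.exp (z * n)) n {z | z.re ≤ 0} 0 := by
      have := ((hasDerivAt_id (0 : ℂ)).mul_const (n : ℂ)).cexp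
      simpa using this.hasDerivWithinAt
    rw [hasDerivWithinAt_iff_tendsto_slope, ← tendsto_sub_nhds_zero_iff] at hd
    have := hd.smul_const (coord U n v)
    rw [zero_smul] at this
    refine this.congr' ?_
    filter_upwards [self_mem_nhdsWithin] with z hz
    rw [hcoord hz.1]

/-- The number operator generates the semigroup along each ray `t ↦ t a` in the half-plane. -/
theorem IsExpDiagonal.mem_graph_iff (hS : IsExpDiagonal U S) {a : ℂ} (ha : a ≠ 0) {s : Set ℝ}
    (hs : ∀ t ∈ s, (t * a : ℂ).re ≤ 0) (h0 : 0 ∈ s) (hu : UniqueDiffWithinAt ℝ s 0) {v w : H} :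
    (v, w) ∈ (numOp U).graph ↔ HasDerivWithinAt (fun t : ℝ => S (t * a) v) (a • w) s 0 := by
  have hγ : HasDerivWithinAt (fun t : ℝ => (t * a : ℂ)) a s 0 := by
    simpa using ((hasDerivAt_id (0 : ℝ)).ofReal_comp.mul_const a).hasDerivWithinAt
  rw [mem_graph_numOp]
  refine ⟨fun h => ?_, fun h n => ?_⟩
  · have h1 := hS.hasDerivWithinAt h
    exact HasDerivWithinAt.scomp_of_eq (t' := {z : ℂ | z.re ≤ 0}) 0 h1 hγ hs (by simp)
  · have h1 : HasDerivWithinAt (fun t : ℝ => coord U n (S (t * a) v)) (coord U n (a • w)) s 0 :=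
      ((coord U n).restrictScalars ℝ).hasFDerivAt.comp_hasDerivWithinAt 0 h
    have h2 : HasDerivWithinAt (fun t : ℝ => Complex.exp (t * a * n) • coord U n v)
        ((a * n) • coord U n v) s 0 := by
      have := ((hγ.mul_const (n : ℂ)).cexp).smul_const (coord U n v)
      simpa using this
    have h3 := hu.eq_deriv s h1 (h2.congr (fun t ht => hS _ (hs t ht) v n) (hS _ (hs 0 h0) v n))
    rw [map_smul, mul_smul] at h3
    exact smul_right_injective _ ha h3

end Diagonal

/-! ### Hilbert sums of subspaces -/

section HilbertSum

variable {H : Type*} [NormedAddCommGroup H] [InnerProductSpace ℂ H] {P : ℕ → Submodule ℂ H}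

/-- The Hilbert sum decomposition along a total orthogonal family of closed subspaces. -/
theorem exists_hilbertSum [CompleteSpace H] (hc : ∀ n, IsClosed (P n : Set H))
    (ho : OrthogonalFamily ℂ (fun n => P n) fun n => (P n).subtypeₗᵢ)
    (ht : (⨆ n, P n).topologicalClosure = ⊤) :
    ∃ U : H ≃ₗᵢ[ℂ] lp (fun n => P n) 2, ∀ n v, v ∈ P n ↔ ∀ k ≠ n, coord U k v = 0 := by
  have (n : ℕ) : CompleteSpace (P n) := (hc n).completeSpace_coe
  have hsum := IsHilbertSum.mkInternal P ho ht.ge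
  refine ⟨hsum.linearIsometryEquiv, fun n v => ⟨fun hv k hk => ?_, fun h => ?_⟩⟩
  · have h1 := hsum.linearIsometryEquiv_symm_apply_single (⟨v, hv⟩ : P n)
    rw [LinearIsometryEquiv.symm_apply_eq] at h1
    change hsum.linearIsometryEquiv v k = 0
    rw [show v = (P n).subtypeₗᵢ ⟨v, hv⟩ from rfl, ← h1, lp.single_apply_ne _ _ _ hk]
  · have h1 := hsum.linearIsometryEquiv_symm_apply_single (coord hsum.linearIsometryEquiv n v)
    have h2 : v = (P n).subtypeₗᵢ (coord hsum.linearIsometryEquiv n v) := by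
      rw [← h1, LinearIsometryEquiv.eq_symm_apply]
      refine lp.ext (funext fun k => ?_)
      by_cases hk : k = n
      · subst hk
        rw [lp.single_apply_self, coord_apply]
      · rw [lp.single_apply_ne _ _ _ hk]
        exact h k hk
    rw [h2]
    exact Subtype.coe_prop _

theorem exists_contraction_of_denseRange [CompleteSpace H] {E : Type*} [AddCommGroup E]
    [Module ℂ E] {e f : E →ₗ[ℂ] H} (he : DenseRange e) (h : ∀ x, ‖f x‖ ≤ 1 * ‖e x‖) :
    ∃ D : H →L[ℂ] H, ‖D‖ ≤ 1 ∧ ∀ x, D (e x) = f x :=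
  ⟨f.extendOfNorm e, LinearMap.opNorm_extendOfNorm_le he zero_le_one h,
    LinearMap.extendOfNorm_eq he ⟨1, h⟩⟩

/-- A family of contractions between dense parts of the summands extends to the Hilbert sum. -/
theorem exists_contraction_of_family [CompleteSpace H] {E : Type*} [AddCommGroup E] [Module ℂ E]
    (ho : OrthogonalFamily ℂ (fun n => P n) fun n => (P n).subtypeₗᵢ) {e f : ℕ → E →ₗ[ℂ] H}
    (he : ∀ n x, e n x ∈ P n) (hf : ∀ n x, f n x ∈ P n)
    (ht : (⨆ n, LinearMap.range (e n)).topologicalClosure = ⊤)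
    (hle : ∀ n x, ‖f n x‖ ≤ ‖e n x‖) :
    ∃ D : H →L[ℂ] H, ‖D‖ ≤ 1 ∧ ∀ n x, D (e n x) = f n x := by
  have hnorm {e : ℕ → E →ₗ[ℂ] H} (he : ∀ n x, e n x ∈ P n) (x : ℕ →₀ E) :
      ‖Finsupp.lsum ℂ e x‖ ^ 2 = ∑ n ∈ x.support, ‖e n (x n)‖ ^ 2 := by
    rw [Finsupp.lsum_apply, Finsupp.sum]
    simpa using ho.norm_sum (fun n => (⟨_, he n (x n)⟩ : P n)) x.support
  have hle' (x : ℕ →₀ E) : ‖Finsupp.lsum ℂ f x‖ ≤ 1 * ‖Finsupp.lsum ℂ e x‖ := by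
    rw [one_mul]
    refine le_of_sq_le_sq ?_ (norm_nonneg _)
    rw [hnorm he, hnorm hf]
    exact Finset.sum_le_sum fun n _ => pow_le_pow_left₀ (norm_nonneg _) (hle n _) 2
  have hdense : DenseRange (Finsupp.lsum ℂ e) := by
    refine (Submodule.dense_iff_topologicalClosure_eq_top.2 ht).mono ?_
    rw [← LinearMap.coe_range, SetLike.coe_subset_coe]
    refine iSup_le fun n => ?_
    rintro _ ⟨x, rfl⟩
    exact ⟨Finsupp.single n x, by simp⟩
  obtain ⟨D, hD1, hD⟩ := exists_contraction_of_denseRange hdense hle'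
  exact ⟨D, hD1, fun n x => by simpa using hD (Finsupp.single n x)⟩

end HilbertSum

open Model

variable {d : ℕ} {c : ℝ} {hc : 0 < c}

/-! ### The particle spaces -/

theorem fockState_eq_vac (hc : 0 < c) (d : ℕ) : fockState hc d = vac c d :=
  (isFockState_fockState hc d).unique ⟨vac_one, vac_nonneg hc, vac_mul_an, vac_mul_nu⟩

/-- The map `x ↦ x Φ` as a linear map. -/
noncomputable def toFockL (hc : 0 < c) (d : ℕ) : RSWN c d →ₗ[ℂ] Fock hc d :=
  (UniformSpace.Completion.toComplL : PreFock hc d →L[ℂ] Fock hc d).toLinearMap ∘ₗ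
    (toPreFock hc d).toLinearMap

theorem toFockL_apply (x : RSWN c d) : toFockL hc d x = toFock hc d x := rfl

theorem cr_pow_mem_words (f : TestAlg d) (n : ℕ) : cr c f ^ n ∈ words c d n := by
  have := list_mem_words (c := c) (List.replicate n f)
  simpa using this

theorem particleVec_smul (z : ℂ) (f : TestAlg d) (n : ℕ) :
    particleVec hc n (z • f) = z ^ n • particleVec hc n f := by
  rw [particleVec, particleVec, cr_smul, smul_pow, ← toFockL_apply, map_smul, toFockL_apply]

theorem particleVec_zero (f : TestAlg d) : particleVec hc 0 f = vacuum hc d := by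
  rw [particleVec, pow_zero, vacuum]

theorem inner_particleVec (n : ℕ) (f g : TestAlg d) :
    inner ℂ (particleVec hc n f) (particleVec hc n g) = gramA c d n f g := by
  rw [particleVec, particleVec, inner_toFock, fockState_eq_vac, star_cr_pow, gramA]

theorem inner_particleVec_of_ne {m n : ℕ} (h : m ≠ n) (f g : TestAlg d) :
    inner ℂ (particleVec hc m f) (particleVec hc n g) = 0 := by
  rw [particleVec, particleVec, inner_toFock, fockState_eq_vac]
  exact vac_orth h (cr_pow_mem_words f m) (cr_pow_mem_words g n)

theorem particleVec_mem (n : ℕ) (f : TestAlg d) :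
    particleVec hc n f ∈ particleSpace hc d n :=
  Submodule.le_topologicalClosure _ (Submodule.subset_span ⟨f, rfl⟩)

theorem orthogonalFamily_particleSpace (hc : 0 < c) (d : ℕ) :
    OrthogonalFamily ℂ (fun n => particleSpace hc d n) fun n => (particleSpace hc d n).subtypeₗᵢ := by
  refine OrthogonalFamily.of_pairwise fun m n hmn => ?_
  refine Submodule.topologicalClosure_minimal _ ?_ (Submodule.isClosed_orthogonal _)
  rw [particleSpace, Submodule.orthogonal_closure]
  refine Submodule.isOrtho_span.2 ?_
  rintro _ ⟨f, rfl⟩ _ ⟨g, rfl⟩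
  exact inner_particleVec_of_ne hmn f g

theorem toFock_killed {x : RSWN c d} (hx : x ∈ killed c d) : toFock hc d x = 0 := by
  rw [← inner_self_eq_zero (𝕜 := ℂ), inner_toFock, fockState_eq_vac]
  exact vac_killed (mul_mem_killed _ hx)

/-- The vectors `(B⁺_f)ⁿ Φ` are total, by normal ordering. -/
theorem topologicalClosure_eq_top_of_particleVec_mem {V : Submodule ℂ (Fock hc d)}
    (h : ∀ n f, particleVec hc n f ∈ V.topologicalClosure) : V.topologicalClosure = ⊤ := by
  have hx (x : RSWN c d) : toFock hc d x ∈ V.topologicalClosure := by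
    have hw : (⨆ n, words c d n) ⊔ killed c d ≤ V.topologicalClosure.comap (toFockL hc d) := by
      refine sup_le (iSup_le fun n => (words_le_powers n).trans (Submodule.span_le.2 ?_)) ?_
      · rintro _ ⟨f, rfl⟩
        exact h n f
      · intro x hx
        rw [Submodule.mem_comap, toFockL_apply, toFock_killed hx]
        exact zero_mem _
    exact hw (mem_sup_words x)
  refine Submodule.eq_top_iff'.2 fun v => ?_
  induction v using UniformSpace.Completion.induction_on with
  | hp => exact V.isClosed_topologicalClosure
  | ih x => exact hx x

theorem topologicalClosure_iSup_particleSpace (hc : 0 < c) (d : ℕ) :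
    (⨆ n, particleSpace hc d n).topologicalClosure = ⊤ :=
  topologicalClosure_eq_top_of_particleVec_mem fun n f =>
    Submodule.le_topologicalClosure _ (Submodule.mem_iSup_of_mem n (particleVec_mem n f))

theorem exists_fockEquiv (hc : 0 < c) (d : ℕ) :
    ∃ U : Fock hc d ≃ₗᵢ[ℂ] lp (fun n => particleSpace hc d n) 2,
      ∀ n v, v ∈ particleSpace hc d n ↔ ∀ k ≠ n, coord U k v = 0 :=
  exists_hilbertSum (fun _ => Submodule.isClosed_topologicalClosure _)
    (orthogonalFamily_particleSpace hc d) (topologicalClosure_iSup_particleSpace hc d)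

/-! ### Exponential vectors -/

theorem integrable_norm_sq (f : TestAlg d) : Integrable fun s => ‖f.1 s‖ ^ 2 :=
  (memLp_two_iff_integrable_sq_norm f.2.1.1).1 f.2.1

theorem l2inner_self (f : TestAlg d) : l2inner f f = ((∫ s, ‖f.1 s‖ ^ 2 : ℝ) : ℂ) := by
  rw [l2inner, ← integral_complex_ofReal]
  congr 1
  ext x
  rw [Complex.conj_mul']
  push_cast
  rfl

theorem integral_norm_sq_mul_le {f : TestAlg d} {b : ℝ} (hf : ∀ᵐ s, ‖f.1 s‖ ≤ b)
    (g : TestAlg d) : ∫ s, ‖(f * g).1 s‖ ^ 2 ≤ b ^ 2 * ∫ s, ‖g.1 s‖ ^ 2 := by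
  rw [← integral_const_mul]
  refine integral_mono_ae (integrable_norm_sq _) ((integrable_norm_sq g).const_mul _) ?_
  filter_upwards [hf, mul_ae f g] with s h1 h2
  rw [h2, norm_mul, mul_pow]
  gcongr

theorem integral_norm_sq_spow_le {f : TestAlg d} {b : ℝ} (hf : ∀ᵐ s, ‖f.1 s‖ ≤ b) (k : ℕ) :
    ∫ s, ‖(spow f k).1 s‖ ^ 2 ≤ b ^ (2 * k) * ∫ s, ‖f.1 s‖ ^ 2 := by
  induction k with
  | zero => simp [spow]
  | succ k ih =>
    refine (integral_norm_sq_mul_le hf _).trans ?_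
    calc _ ≤ b ^ 2 * (b ^ (2 * k) * ∫ s, ‖f.1 s‖ ^ 2) := by gcongr
      _ = _ := by ring

theorem exists_ae_norm_le (f : TestAlg d) : ∃ b : ℝ, ∀ᵐ s, ‖f.1 s‖ ≤ b := by
  refine ⟨(eLpNorm f.1 ∞ volume).toReal, ?_⟩
  filter_upwards [ae_le_eLpNormEssSup (f := (f.1 : EuclideanSpace ℝ (Fin d) → ℂ))] with s hs
  rw [← eLpNorm_exponent_top] at hs
  rw [← toReal_enorm]
  exact ENNReal.toReal_mono f.2.2.2.ne hs

/-- Iterating the recursion for the Gram matrices on the diagonal: with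
`K = 4 ‖f‖²_∞ + 2c ‖f‖²_2`, the square norm of `(B⁺_f)ⁿ Φ` is at most `(n!)² Kⁿ`. The bound for
`gramQ`, uniform in `k` up to the factor `‖f‖_∞^{2k}`, carries the induction. -/
theorem norm_gram_le (hc : 0 < c) {f : TestAlg d} {b : ℝ} (hf : ∀ᵐ s, ‖f.1 s‖ ≤ b) (n : ℕ) :
    ‖gramA c d n f f‖ ≤
        (n.factorial : ℝ) ^ 2 * (4 * b ^ 2 + 2 * c * ∫ s, ‖f.1 s‖ ^ 2) ^ n ∧
      ∀ k, ‖gramQ c d k n f f‖ ≤ 2 * c * (∫ s, ‖f.1 s‖ ^ 2) * b ^ (2 * k) *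
        ((n + 1).factorial : ℝ) ^ 2 * (4 * b ^ 2 + 2 * c * ∫ s, ‖f.1 s‖ ^ 2) ^ n := by
  set s := ∫ s, ‖f.1 s‖ ^ 2 with hs
  have hs0 : 0 ≤ s := integral_nonneg fun _ => by positivity
  set K := 4 * b ^ 2 + 2 * c * s with hK
  have hK0 : 0 ≤ K := by positivity
  have hM (k : ℕ) : ‖gramM d k f f‖ ≤ b ^ (2 * k) * s := by
    rw [gramM, l2inner_self, Complex.norm_real, Real.norm_of_nonneg
      (integral_nonneg fun _ => by positivity)]
    exact integral_norm_sq_spow_le hf k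
  have hb (k : ℕ) : 0 ≤ b ^ (2 * k) := by rw [pow_mul]; positivity
  have hQ (k n : ℕ) : ‖gramQ c d k n f f‖ ≤
      2 * c * (n + 1) * (‖gramM d k f f‖ * ‖gramA c d n f f‖) +
        4 * (n + 1) * n * ‖gramQ c d (k + 1) (n - 1) f f‖ := by
    rw [gramQ_eq]
    simp only [Matrix.add_apply, Matrix.smul_apply, Matrix.hadamard_apply,
      Matrix.conjTranspose_apply, smul_eq_mul]
    refine (norm_add_le _ _).trans (le_of_eq ?_)
    have hn : ‖(n : ℂ) + 1‖ = n + 1 := by exact_mod_cast Complex.norm_natCast (n + 1)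
    simp [abs_of_pos hc, hn]
  induction n with
  | zero =>
    refine ⟨by simp [gramA, vac_one], fun k => (hQ k 0).trans ?_⟩
    have h1 : ‖gramA c d 0 f f‖ = 1 := by simp [gramA, vac_one]
    rw [h1]
    simp only [CharP.cast_eq_zero, zero_add, mul_one, mul_zero, zero_mul, add_zero,
      Nat.factorial_one, Nat.cast_one, one_pow, pow_zero]
    calc _ ≤ 2 * c * (b ^ (2 * k) * s) := by gcongr; exact hM k
      _ = _ := by ring
  | succ n ih =>
    have hA : ‖gramA c d (n + 1) f f‖ ≤ ((n + 1).factorial : ℝ) ^ 2 * K ^ (n + 1) := by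
      rw [gramA_succ]
      refine (ih.2 0).trans ?_
      calc _ = ((n + 1).factorial : ℝ) ^ 2 * K ^ n * (2 * c * s) := by ring
        _ ≤ ((n + 1).factorial : ℝ) ^ 2 * K ^ n * K := by
          gcongr
          rw [hK]
          nlinarith [sq_nonneg b]
        _ = _ := by ring
    refine ⟨hA, fun k => (hQ k (n + 1)).trans ?_⟩
    have hbk := hb k
    rw [Nat.add_sub_cancel, Nat.factorial_succ (n + 1)]
    push_cast
    set F : ℝ := ((n + 1).factorial : ℝ) ^ 2
    calc _ ≤ 2 * c * (n + 1 + 1) * (b ^ (2 * k) * s * (F * K ^ (n + 1))) +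
          4 * (n + 1 + 1) * (n + 1) * (2 * c * s * b ^ (2 * (k + 1)) * F * K ^ n) := by
          gcongr
          · exact hM k
          · exact ih.2 (k + 1)
      _ = 2 * c * (n + 1 + 1) * b ^ (2 * k) * s * F * K ^ n * (K + (n + 1) * (4 * b ^ 2)) := by
          ring
      _ ≤ 2 * c * (n + 1 + 1) * b ^ (2 * k) * s * F * K ^ n * (K + (n + 1) * K) := by
          gcongr
          rw [hK]
          have : 0 ≤ c * s := by positivity
          linarith
      _ = _ := by ring

theorem exists_norm_particleVec_le (hc : 0 < c) (f : TestAlg d) :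
    ∃ R : ℝ, 0 ≤ R ∧ ∀ n, ‖particleVec hc n f‖ ≤ n.factorial * R ^ n := by
  obtain ⟨b, hb⟩ := exists_ae_norm_le f
  set K := 4 * b ^ 2 + 2 * c * ∫ s, ‖f.1 s‖ ^ 2 with hK
  have hK0 : 0 ≤ K := by
    have : 0 ≤ ∫ s, ‖f.1 s‖ ^ 2 := integral_nonneg fun _ => by positivity
    positivity
  refine ⟨√K, Real.sqrt_nonneg _, fun n => ?_⟩
  refine le_of_sq_le_sq ?_ (by positivity)
  have h := (norm_gram_le hc hb n).1
  rw [← inner_particleVec (hc := hc), inner_self_eq_norm_sq_to_K] at h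
  rw [mul_pow, ← pow_mul, mul_comm n, pow_mul, Real.sq_sqrt hK0]
  simpa using h

theorem exists_isExpVec_smul (hc : 0 < c) (f : TestAlg d) :
    ∀ᶠ t : ℂ in nhds 0, ∃ v, IsExpVec hc (t • f) v := by
  obtain ⟨R, hR0, hR⟩ := exists_norm_particleVec_le hc f
  have hball : ∀ᶠ t : ℂ in nhds 0, ‖t‖ * R < 1 := by
    have : ContinuousAt (fun t : ℂ => ‖t‖ * R) 0 := by fun_prop
    exact this.eventually_lt_const (by simp)
  filter_upwards [hball] with t ht
  refine (Summable.of_norm_bounded (summable_geometric_of_lt_one (by positivity) ht)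
    fun n => ?_ : Summable fun n : ℕ => ((n.factorial : ℂ)⁻¹) • particleVec hc n (t • f))
  have hn : 0 < (n.factorial : ℝ) := by exact_mod_cast n.factorial_pos
  rw [particleVec_smul, norm_smul, norm_smul, norm_inv, norm_pow, Complex.norm_natCast,
    inv_mul_le_iff₀ hn, mul_pow]
  calc _ ≤ ‖t‖ ^ n * (n.factorial * R ^ n) := by gcongr; exact hR n
    _ = _ := by ring

/-- The exponential vectors are total: a vector orthogonal to all `Ψ(t f)`, `t` small, is
orthogonal to the Taylor coefficients of `t ↦ Ψ(t f)`. -/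
theorem topologicalClosure_expSpan (hc : 0 < c) (d : ℕ) :
    (expSpan hc d).topologicalClosure = ⊤ := by
  refine topologicalClosure_eq_top_of_particleVec_mem fun n f => ?_
  rw [← Submodule.orthogonal_orthogonal_eq_closure, Submodule.mem_orthogonal]
  intro y hy
  let a : ℕ → ℂ := fun n => inner ℂ y (((n.factorial : ℂ)⁻¹) • particleVec hc n f)
  have hp : HasFPowerSeriesAt (fun _ : ℂ => (0 : ℂ)) (FormalMultilinearSeries.ofScalars ℂ a) 0 := by
    rw [hasFPowerSeriesAt_iff]
    filter_upwards [exists_isExpVec_smul hc f] with t ⟨v, hv⟩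
    have h := hv.mapL (innerSL ℂ y)
    simp only [innerSL_apply_apply] at h
    rw [(Submodule.mem_orthogonal' _ _).1 hy v (Submodule.subset_span ⟨_, hv⟩)] at h
    refine h.congr_fun fun n => ?_
    rw [particleVec_smul, smul_comm, inner_smul_right, FormalMultilinearSeries.coeff_ofScalars,
      smul_eq_mul]
  have h0 : a n = 0 := by
    rw [← FormalMultilinearSeries.coeff_ofScalars (p := a) (n := n), hp.eq_zero]
    rfl
  simp only [a] at h0
  rw [inner_smul_right, mul_eq_zero, inv_eq_zero] at h0
  exact h0.resolve_left (by exact_mod_cast n.factorial_ne_zero)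

theorem dense_expSpan (hc : 0 < c) (d : ℕ) : Dense (expSpan hc d : Set (Fock hc d)) :=
  Submodule.dense_iff_topologicalClosure_eq_top.2 (topologicalClosure_expSpan hc d)

/-! ### Second quantization -/

/-- A bounded operator that maps `(B⁺_f)ⁿ Φ` to `(B⁺_{Tf})ⁿ Φ` restricts to `Γ₂(T)`. -/
theorem isSecondQuantization_toPMap {T : TestAlg d →ₗ[ℂ] TestAlg d}
    (D : Fock hc d →L[ℂ] Fock hc d)
    (hD : ∀ n f, D (particleVec hc n f) = particleVec hc n (T f)) :
    IsSecondQuantization hc T ((D : Fock hc d →ₗ[ℂ] Fock hc d).toPMap (expSpan hc d)) := by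
  refine ⟨rfl, fun f v hv => ⟨D v, ?_, ?_⟩⟩
  · have h := hv.mapL D
    simp only [map_smul, hD] at h
    exact h
  · exact (LinearPMap.mem_graph_iff _).2 ⟨⟨v, Submodule.subset_span ⟨f, hv⟩⟩, rfl, rfl⟩

theorem sum_star_mul_l2inner (x : TestAlg d →₀ ℂ) (u : TestAlg d → TestAlg d) :
    (x.sum fun i a => x.sum fun j b => star a * l2inner (u i) (u j) * b) =
      l2inner (Finsupp.linearCombination ℂ u x) (Finsupp.linearCombination ℂ u x) := by
  have hr (v : TestAlg d) : l2inner v (Finsupp.linearCombination ℂ u x) =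
      x.sum fun i a => a * l2inner v (u i) := by
    rw [Finsupp.linearCombination_apply]
    simpa only [pairL_apply, map_smul, smul_eq_mul] using
      map_finsuppSum (pairL v) x fun i a => a • u i
  rw [hr]
  simp only [← l2inner_conj (u _) (Finsupp.linearCombination ℂ u x), hr, Finsupp.sum, map_sum,
    map_mul, l2inner_conj, Finset.mul_sum]
  rw [Finset.sum_comm]
  exact Finset.sum_congr rfl fun i _ => Finset.sum_congr rfl fun j _ => by
    rw [Complex.star_def]; ring

theorem sum_star_mul_gramA (hc : 0 < c) (x : TestAlg d →₀ ℂ) (n : ℕ) (u : TestAlg d → TestAlg d) :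
    (x.sum fun i a => x.sum fun j b => star a * gramA c d n (u i) (u j) * b) =
      ((‖Finsupp.linearCombination ℂ (fun f => particleVec hc n (u f)) x‖ ^ 2 : ℝ) : ℂ) := by
  rw [Complex.ofReal_pow]
  refine Eq.trans ?_ (inner_self_eq_norm_sq_to_K (𝕜 := ℂ)
    (Finsupp.linearCombination ℂ (fun f => particleVec hc n (u f)) x))
  rw [Finsupp.linearCombination_apply, Finsupp.sum_inner]
  refine Finset.sum_congr rfl fun i _ => ?_
  dsimp only
  rw [Finsupp.inner_sum]
  simp only [Finsupp.sum, inner_smul_left, inner_smul_right, inner_particleVec]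
  exact Finset.sum_congr rfl fun j _ => by rw [Complex.star_def]; ring

/-- Entrywise products respect the order of positive semidefinite matrices. -/
theorem posSemidef_hadamard_sub {ι : Type*} {A A' B B' : Matrix ι ι ℂ} (hA' : A'.PosSemidef)
    (hB : B.PosSemidef) (hA : (A - A').PosSemidef) (hB' : (B - B').PosSemidef) :
    (A.hadamard B - A'.hadamard B').PosSemidef := by
  have : A.hadamard B - A'.hadamard B' = (A - A').hadamard B + A'.hadamard (B - B') := by
    ext i j
    simp only [Matrix.sub_apply, Matrix.add_apply, Matrix.hadamard_apply]
    ring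
  rw [this]
  exact (hA.hadamard hB).add (hA'.hadamard hB')

/-- If the Gram matrices of all powers decrease under `T`, then so do those of the particle
vectors. The recursion expresses the latter through the former with positive coefficients and
entrywise products. -/
theorem posSemidef_gram_sub (hc : 0 < c) {T : TestAlg d → TestAlg d}
    (hT : ∀ k, (gramM d k - (gramM d k).submatrix T T).PosSemidef) (n : ℕ) :
    (gramA c d n - (gramA c d n).submatrix T T).PosSemidef ∧
      ∀ k, (gramQ c d k n - (gramQ c d k n).submatrix T T).PosSemidef := by
  have hc0 : (0 : ℂ) ≤ c := by exact_mod_cast hc.le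
  have hQ (k n : ℕ) : gramQ c d k n - (gramQ c d k n).submatrix T T =
      (2 * c * ((n : ℂ) + 1)) • ((gramM d k).hadamard (gramA c d n) -
          ((gramM d k).submatrix T T).hadamard ((gramA c d n).submatrix T T)) +
        (4 * ((n : ℂ) + 1) * n) • (gramQ c d (k + 1) (n - 1) -
          (gramQ c d (k + 1) (n - 1)).submatrix T T).conjTranspose := by
    rw [gramQ_eq]
    ext i j
    simp only [Matrix.sub_apply, Matrix.add_apply, Matrix.smul_apply, Matrix.hadamard_apply,
      Matrix.conjTranspose_apply, Matrix.submatrix_apply, smul_eq_mul, star_sub]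
    ring
  have hMA (k n : ℕ) (h : (gramA c d n - (gramA c d n).submatrix T T).PosSemidef) :
      ((gramM d k).hadamard (gramA c d n) -
        ((gramM d k).submatrix T T).hadamard ((gramA c d n).submatrix T T)).PosSemidef :=
    posSemidef_hadamard_sub ((gramM_psd k).submatrix T) (gram_psd hc n).1 (hT k) h
  induction n with
  | zero =>
    have hA : (gramA c d 0 - (gramA c d 0).submatrix T T).PosSemidef := by
      have : gramA c d 0 - (gramA c d 0).submatrix T T = 0 := by
        ext i j
        simp [gramA]
      rw [this]
      exact Matrix.PosSemidef.zero
    refine ⟨hA, fun k => ?_⟩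
    rw [hQ]
    simp only [Nat.cast_zero, mul_zero, zero_smul, add_zero]
    exact (hMA k 0 hA).smul (by positivity)
  | succ n ih =>
    have hA : (gramA c d (n + 1) - (gramA c d (n + 1)).submatrix T T).PosSemidef := by
      rw [gramA_succ]
      exact ih.2 0
    refine ⟨hA, fun k => ?_⟩
    rw [hQ]
    exact ((hMA k _ hA).smul (by positivity)).add ((ih.2 (k + 1)).conjTranspose.smul (by positivity))

theorem integral_norm_sq_le_of_eLpNorm_le {f g : TestAlg d}
    (h : eLpNorm f.1 2 volume ≤ eLpNorm g.1 2 volume) :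
    ∫ s, ‖f.1 s‖ ^ 2 ≤ ∫ s, ‖g.1 s‖ ^ 2 := by
  have hf0 : 0 ≤ ∫ s, ‖f.1 s‖ ^ 2 := integral_nonneg fun _ => by positivity
  have hg0 : 0 ≤ ∫ s, ‖g.1 s‖ ^ 2 := integral_nonneg fun _ => by positivity
  rw [f.2.1.eLpNorm_eq_integral_rpow_norm two_ne_zero ENNReal.ofNat_ne_top,
    g.2.1.eLpNorm_eq_integral_rpow_norm two_ne_zero ENNReal.ofNat_ne_top] at h
  simp only [ENNReal.toReal_ofNat, Real.rpow_ofNat] at h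
  rw [ENNReal.ofReal_le_ofReal_iff (by positivity)] at h
  exact (Real.rpow_le_rpow_iff hf0 hg0 (by norm_num)).1 h

theorem mul_mulL_pow (φ a b : TestAlg d) (k : ℕ) :
    a * (mulL φ ^ k) b = (mulL φ ^ k) (a * b) := by
  induction k generalizing b with
  | zero => simp
  | succ k ih =>
    rw [pow_succ, Module.End.mul_apply, Module.End.mul_apply, ih, mulL_apply, mulL_apply,
      mul_left_comm]

/-- For `T = M_φ T₁` the powers transform linearly: `(T f)^{k+1} = φᵏ T (f^{k+1})`. -/
theorem spow_apply_eq {φ : TestAlg d} {T₁ : TestAlg d →ₙₐ[ℂ] TestAlg d}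
    {T : TestAlg d →ₗ[ℂ] TestAlg d} (hT : ∀ f, T f = φ * T₁ f) (f : TestAlg d) (k : ℕ) :
    spow (T f) k = (mulL φ ^ k * T : Module.End ℂ (TestAlg d)) (spow f k) := by
  induction k with
  | zero => simp [spow]
  | succ k ih =>
    have h : T f * T (spow f k) = φ * T (f * spow f k) := by
      rw [hT, hT, hT, map_mul]
      ac_rfl
    rw [spow, ih, Module.End.mul_apply, mul_mulL_pow, h, pow_succ, Module.End.mul_apply,
      Module.End.mul_apply, mulL_apply, spow]

theorem posSemidef_gramM_sub {φ : TestAlg d} {T₁ : TestAlg d →ₙₐ[ℂ] TestAlg d}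
    {T : TestAlg d →ₗ[ℂ] TestAlg d} (hφ : eLpNorm φ.1 ∞ volume ≤ 1) (hT : ∀ f, T f = φ * T₁ f)
    (hT2 : ∀ f, eLpNorm (T f).1 2 volume ≤ eLpNorm f.1 2 volume) (k : ℕ) :
    (gramM d k - (gramM d k).submatrix T T).PosSemidef := by
  have hφ1 : ∀ᵐ s, ‖φ.1 s‖ ≤ 1 := by
    filter_upwards [ae_le_eLpNormEssSup (f := (φ.1 : EuclideanSpace ℝ (Fin d) → ℂ))] with s hs
    rw [← eLpNorm_exponent_top] at hs
    rw [← toReal_enorm]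
    exact ENNReal.toReal_le_of_le_ofReal zero_le_one (by simpa using hs.trans hφ)
  have hpow (h : TestAlg d) (k : ℕ) :
      ∫ s, ‖((mulL φ ^ k * T : Module.End ℂ (TestAlg d)) h).1 s‖ ^ 2 ≤ ∫ s, ‖h.1 s‖ ^ 2 := by
    induction k with
    | zero => simpa using integral_norm_sq_le_of_eLpNorm_le (hT2 h)
    | succ k ih =>
      rw [pow_succ', mul_assoc, Module.End.mul_apply, mulL_apply]
      refine (integral_norm_sq_mul_le hφ1 _).trans ?_
      simpa using ih
  refine ⟨(gramM_psd k).1.sub ((gramM_psd k).1.submatrix T), fun x => ?_⟩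
  have h1 := sum_star_mul_l2inner x fun f => spow f k
  have h2 := sum_star_mul_l2inner x fun f => spow (T f) k
  have h3 : Finsupp.linearCombination ℂ (fun f => spow (T f) k) x =
      (mulL φ ^ k * T : Module.End ℂ (TestAlg d))
        (Finsupp.linearCombination ℂ (fun f => spow f k) x) := by
    simp only [spow_apply_eq hT]
    exact (Finsupp.apply_linearCombination ℂ _ _ _).symm
  have h4 : (x.sum fun i a => x.sum fun j b =>
      star a * (gramM d k - (gramM d k).submatrix T T) i j * b) =
      (x.sum fun i a => x.sum fun j b => star a * l2inner (spow i k) (spow j k) * b) -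
      x.sum fun i a => x.sum fun j b => star a * l2inner (spow (T i) k) (spow (T j) k) * b := by
    simp only [Finsupp.sum, ← Finset.sum_sub_distrib, Matrix.sub_apply, Matrix.submatrix_apply,
      gramM, mul_sub, sub_mul]
  rw [h4, h1, h2, h3, l2inner_self, l2inner_self, ← Complex.ofReal_sub]
  exact_mod_cast sub_nonneg.2 (hpow _ k)

/-- A map of test functions that contracts all Gram matrices of particle vectors induces a
contraction of the Fock space. -/
theorem exists_contraction (hc : 0 < c) {T : TestAlg d → TestAlg d}
    (hT : ∀ n, (gramA c d n - (gramA c d n).submatrix T T).PosSemidef) :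
    ∃ D : Fock hc d →L[ℂ] Fock hc d, ‖D‖ ≤ 1 ∧
      ∀ n f, D (particleVec hc n f) = particleVec hc n (T f) := by
  have hmem (u : TestAlg d → TestAlg d) (n : ℕ) (x : TestAlg d →₀ ℂ) :
      Finsupp.linearCombination ℂ (fun f => particleVec hc n (u f)) x ∈ particleSpace hc d n := by
    rw [Finsupp.linearCombination_apply]
    exact Submodule.sum_mem _ fun f _ => Submodule.smul_mem _ _ (particleVec_mem n (u f))
  have hdense : (⨆ n, LinearMap.range (Finsupp.linearCombination ℂ
      fun f => particleVec hc n f : (TestAlg d →₀ ℂ) →ₗ[ℂ] Fock hc d)).topologicalClosure = ⊤ := by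
    refine topologicalClosure_eq_top_of_particleVec_mem fun n f =>
      Submodule.le_topologicalClosure _ (Submodule.mem_iSup_of_mem n ⟨Finsupp.single f 1, ?_⟩)
    rw [Finsupp.linearCombination_single, one_smul]
  have hle (n : ℕ) (x : TestAlg d →₀ ℂ) :
      ‖Finsupp.linearCombination ℂ (fun f => particleVec hc n (T f)) x‖ ≤
        ‖Finsupp.linearCombination ℂ (fun f => particleVec hc n f) x‖ := by
    refine le_of_sq_le_sq ?_ (norm_nonneg _)
    have h := (hT n).2 x
    have hsub : (x.sum fun i a => x.sum fun j b =>
        star a * (gramA c d n - (gramA c d n).submatrix T T) i j * b) =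
        (x.sum fun i a => x.sum fun j b => star a * gramA c d n i j * b) -
        x.sum fun i a => x.sum fun j b => star a * gramA c d n (T i) (T j) * b := by
      simp only [Finsupp.sum, ← Finset.sum_sub_distrib, Matrix.sub_apply, Matrix.submatrix_apply,
        mul_sub, sub_mul]
    rw [hsub, sum_star_mul_gramA hc x n fun f => f, sum_star_mul_gramA hc x n T, sub_nonneg] at h
    exact_mod_cast h
  obtain ⟨D, hD1, hD⟩ := exists_contraction_of_family (orthogonalFamily_particleSpace hc d)
    (hmem fun f => f) (hmem T) hdense hle
  refine ⟨D, hD1, fun n f => ?_⟩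
  simpa only [Finsupp.linearCombination_single, one_smul] using hD n (Finsupp.single f 1)

theorem IsExpDiagonal.apply_particleVec
    {U : Fock hc d ≃ₗᵢ[ℂ] lp (fun n => particleSpace hc d n) 2}
    (hU : ∀ n v, v ∈ particleSpace hc d n ↔ ∀ k ≠ n, coord U k v = 0)
    {S : ℂ → Fock hc d →L[ℂ] Fock hc d} (hS : IsExpDiagonal U S) {z : ℂ} (hz : z.re ≤ 0) (n : ℕ)
    (f : TestAlg d) : S z (particleVec hc n f) = particleVec hc n (Complex.exp z • f) := by
  rw [hS.apply_of_coord hz ((hU n _).1 (particleVec_mem n f)), particleVec_smul,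
    ← Complex.exp_nat_mul, mul_comm]

end QuadFock

theorem proposition2 (d : ℕ) (c : ℝ) (hc : 0 < c) :
    -- `T = M_φ T₁` a contraction for `L²` and `L^∞` implies that `Γ₂(T)` is a contraction
    (∀ (φ : TestAlg d) (T₁ : TestAlg d →ₙₐ[ℂ] TestAlg d) (T : TestAlg d →ₗ[ℂ] TestAlg d),
      eLpNorm φ.1 ∞ volume ≤ 1 →
      (∀ f, T f = φ * T₁ f) →
      (∀ f, eLpNorm (T f).1 2 volume ≤ eLpNorm f.1 2 volume) →
      (∀ f, eLpNorm (T f).1 ∞ volume ≤ eLpNorm f.1 ∞ volume) →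
      ∃ G : Fock hc d →ₗ.[ℂ] Fock hc d, IsSecondQuantization hc T G ∧
        Dense (G.domain : Set (Fock hc d)) ∧ ∀ x : G.domain, ‖G x‖ ≤ ‖(x : Fock hc d)‖) ∧
    -- the operators `Γ₂(e^z)`, `Re z ≤ 0`
    (∃ S : ℂ → (Fock hc d →L[ℂ] Fock hc d),
      (∀ z : ℂ, z.re ≤ 0 → ‖S z‖ ≤ 1 ∧
        ∃ G : Fock hc d →ₗ.[ℂ] Fock hc d,
          IsSecondQuantization hc (Complex.exp z • LinearMap.id) G ∧
          Dense (G.domain : Set (Fock hc d)) ∧ ∀ x : G.domain, G x = S z x) ∧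
      -- a holomorphic contraction semigroup that fixes the vacuum
      S 0 = 1 ∧
      (∀ z w : ℂ, z.re ≤ 0 → w.re ≤ 0 → S (z + w) = S z ∘L S w) ∧
      (∀ z : ℂ, z.re ≤ 0 → S z (vacuum hc d) = vacuum hc d) ∧
      DifferentiableOn ℂ S {z | z.re < 0} ∧
      (∀ v, ContinuousOn (fun z => S z v) {z | z.re ≤ 0}) ∧
      -- unitary for imaginary `z`
      (∀ t : ℝ, S (t * Complex.I) ∈ unitary (Fock hc d →L[ℂ] Fock hc d)) ∧
      -- the quadratic free Hamiltonian `H₀`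
      ∃ H₀ : Fock hc d →ₗ.[ℂ] Fock hc d,
        IsSelfAdjoint H₀ ∧
        (∀ x : H₀.domain, 0 ≤ inner ℂ (x : Fock hc d) (H₀ x)) ∧
        (∀ v w, (v, w) ∈ H₀.graph ↔
          HasDerivAt (fun t : ℝ => S (t * Complex.I) v) (Complex.I • w) 0) ∧
        (∀ v w, (v, w) ∈ H₀.graph ↔
          HasDerivWithinAt (fun t : ℝ => S (-t) v) (-w) (Set.Ici 0) 0) ∧
        (∀ (n : ℕ) (v : Fock hc d),
          v ∈ particleSpace hc d n ↔ (v, (n : ℂ) • v) ∈ H₀.graph) ∧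
        (∀ (n : ℕ) (v : Fock hc d) (z : ℂ), v ∈ particleSpace hc d n → z.re ≤ 0 →
          S z v = Complex.exp (z * n) • v) ∧
        (⨆ n, particleSpace hc d n).topologicalClosure = ⊤) := by
  refine ⟨fun φ T₁ T hφ hT hT2 _ => ?_, ?_⟩
  · obtain ⟨D, hD1, hD⟩ := exists_contraction hc
      fun n => (posSemidef_gram_sub hc (posSemidef_gramM_sub hφ hT hT2) n).1
    exact ⟨_, isSecondQuantization_toPMap D hD, dense_expSpan hc d, fun x =>
      D.le_of_opNorm_le_of_le hD1 le_rfl |>.trans_eq (one_mul _)⟩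
  · obtain ⟨U, hU⟩ := exists_fockEquiv hc d
    obtain ⟨S, hS, hS1⟩ := exists_isExpDiagonal U
    refine ⟨S, fun z hz => ⟨hS1 z hz, _, isSecondQuantization_toPMap (S z)
        (hS.apply_particleVec hU hz), dense_expSpan hc d, fun _ => rfl⟩,
      hS.zero, fun z w hz hw => hS.add hz hw, fun z hz => ?_, hS.differentiableOn,
      hS.continuousOn, hS.mem_unitary, numOp U, isSelfAdjoint_numOp U, inner_numOp_nonneg,
      fun v w => ?_, fun v w => ?_, fun n v => ?_, fun n v z hv hz => ?_,
      topologicalClosure_iSup_particleSpace hc d⟩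
    · rw [← particleVec_zero 0, hS.apply_particleVec hU hz, particleVec_zero, particleVec_zero]
    · rw [← hasDerivWithinAt_univ]
      exact hS.mem_graph_iff Complex.I_ne_zero (by simp) (Set.mem_univ 0) uniqueDiffWithinAt_univ
    · have h := hS.mem_graph_iff (a := -1) (s := Set.Ici 0) (v := v) (w := w) (by simp)
        (fun t ht => by simpa using ht) Set.self_mem_Ici (uniqueDiffWithinAt_Ici 0)
      simpa only [mul_neg_one, neg_one_smul] using h
    · rw [hU, mem_graph_numOp_natCast_smul]
    · exact hS.apply_of_coord hz ((hU n v).1 hv)
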